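/- Let four bodies of equal mass $m>0$ move in the plane under Newton's equations $m\ddot\rho_i=\sum_{j\ne i}-m^2(\rho_i-\rho_j)/|\rho_i-\rho_j|^3$, with total energy $T-U$, where $T=\frac12\sum_i m|\dot\rho_i|^2$ and $U=\sum_{i<j}m^2/|\rho_i-\rho_j|$. A simultaneous binary collision (SBC) is a configuration in which two disjoint pairs of bodies collide at two different places. Consider symmetric motions, in which bodies 1, 2, 3, 4 are at $(x_1,x_2)$, $(x_2,x_1)$, $(-x_1,-x_2)$, $(-x_2,-x_1)$ at all times. Let $\dot x_1,\dot x_2$ be derivatives in physical time $t$. Put $x_1-x_2=Q_1^2$, $x_1+x_2=Q_2^2$, $P_1=4mQ_1(\dot x_1-\dot x_2)$, $P_2=4mQ_2(\dot x_1+\dot x_2)$ and introduce a regularized time $s$ by $dt/ds=Q_1^2Q_2^2$, with $t=0$ at $s=0$. A symmetric motion, continuous and defined for all time, is called a solution of energy $E$ in the regularized sense if off the collisions it solves Newton's equations and has energy $E$, all its collisions are SBCs, $s\mapsto t$ is an increasing bijection of $\mathbb R$, and it is described as above by functions $(Q_1,Q_2,P_1,P_2)$ of $s\in\mathbb R$ which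 solve, through the collisions, Hamilton's equations of $$\Gamma=\frac1{16m}\left(P_1^2Q_2^2+P_2^2Q_1^2\right)-\sqrt2\,m^2(Q_1^2+Q_2^2)-\frac{\sqrt2\,m^2Q_1^2Q_2^2}{\sqrt{Q_1^4+Q_2^4}}-EQ_1^2Q_2^2$$ on the level $\Gamma=0$ (the formulas for $P_1,P_2$ being required off the collisions). **Theorem.** Let $m>0$. For every $E<0$ there are $r>0$ and $v>0$ and a symmetric solution of energy $E$ in the regularized sense such that: - at time $0$ bodies 1, 2, 3, 4 are at $(r,0)$, $(0,r)$, $(-r,0)$, $(0,-r)$ with velocities $(0,v)$, $(v,0)$, $(0,-v)$, $(-v,0)$; - there is a first collision, at a regularized time $s_0>0$; bodies 1 and 2 collide exactly at the regularized times $s_0+4s_0k$, and bodies 1 and 4 exactly at $3s_0+4s_0k$, $k\in\mathbb Z$; - positions and velocities of the bodies are periodic with period $4s_0$ in regularized time, and the motion is periodic in physical time, with period the value of $t$ at $s=4s_0$; - the positions at $2s_0-s$ are the same as at $s$, and the position of body 1 at $s+2s_0$ is the reflection in the $x$-axis of its position at $s$. Moreover, for some $E<0$ and some $v>0$ there is such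 an orbit with $r=1$, that is, starting from $(\pm1,0)$, $(0,\pm1)$. -/

import Mathlib

/-- The Euclidean plane, in which the bodies move. -/
abbrev Plane : Type := EuclideanSpace ℝ (Fin 2)

/-- The total Newtonian force `∑_{j ≠ i} - m_i m_j (ρ_i - ρ_j) / |ρ_i - ρ_j|³` on body `i` of the
planar `n`-body problem with masses `μ`, in the configuration `ρ`. -/
noncomputable def newtonForce {n : ℕ} (μ : Fin n → ℝ) (ρ : Fin n → Plane) (i : Fin n) : Plane :=
  ∑ j ∈ Finset.univ.erase i, (-(μ i * μ j / ‖ρ i - ρ j‖ ^ 3)) • (ρ i - ρ j)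

/-- The kinetic energy `T = ½ ∑ m_i |u_i|²` for the velocities `u`. -/
noncomputable def kineticEnergy {n : ℕ} (μ : Fin n → ℝ) (u : Fin n → Plane) : ℝ :=
  (1 / 2) * ∑ i, μ i * ‖u i‖ ^ 2

/-- The function `U = ∑_{i < j} m_i m_j / |ρ_i - ρ_j|`. -/
noncomputable def potentialU {n : ℕ} (μ : Fin n → ℝ) (ρ : Fin n → Plane) : ℝ :=
  ∑ i, ∑ j ∈ Finset.Ioi i, μ i * μ j / ‖ρ i - ρ j‖

/-- No two bodies occupy the same position. -/
def CollisionFree {n : ℕ} (ρ : Fin n → Plane) : Prop :=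
  Function.Injective ρ

/-- The motion `x` (positions as functions of physical time) satisfies Newton's equations with
masses `μ` at every instant which is not an instant of collision. -/
def SolvesNewtonOffCollisions {n : ℕ} (μ : Fin n → ℝ) (x : Fin n → ℝ → Plane) : Prop :=
  ∀ t : ℝ, CollisionFree (fun i => x i t) → ∀ i,
    DifferentiableAt ℝ (x i) t ∧
    HasDerivAt (fun t' => μ i • deriv (x i) t') (newtonForce μ (fun j => x j t) i) t

/-- The total energy `T - U` equals `E` at every instant which is not an instant of collision. -/
def HasEnergyOffCollisions {n : ℕ} (μ : Fin n → ℝ) (x : Fin n → ℝ → Plane) (E : ℝ) : Prop :=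
  ∀ t : ℝ, CollisionFree (fun i => x i t) →
    kineticEnergy μ (fun i => deriv (x i) t) - potentialU μ (fun i => x i t) = E

/-- A simultaneous binary collision (SBC) of four bodies: two disjoint pairs of neighbouring bodies
collide, at two different places. -/
def IsSBC (ρ : Fin 4 → Plane) : Prop :=
  (ρ 0 = ρ 1 ∧ ρ 2 = ρ 3 ∧ ρ 0 ≠ ρ 2) ∨ (ρ 0 = ρ 3 ∧ ρ 1 = ρ 2 ∧ ρ 0 ≠ ρ 1)

/-- The symmetric configurations: body 1 at `(x₁, x₂)`, body 2 at `(x₂, x₁)`, body 3 at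
`(-x₁, -x₂)`, body 4 at `(-x₂, -x₁)` (bodies 1 to 4 have the indices 0 to 3). -/
def IsSymmetricConfiguration (ρ : Fin 4 → Plane) : Prop :=
  ρ 1 = !₂[ρ 0 1, ρ 0 0] ∧ ρ 2 = - ρ 0 ∧ ρ 3 = - ρ 1

/-- The regularized Hamiltonian `Γ = (dt/ds) (H - E)` of the symmetric four-body problem with four
masses `m`, in the coordinates `x₁ - x₂ = Q₁²`, `x₁ + x₂ = Q₂²` and their conjugate momenta. -/
noncomputable def regularizedHamiltonian (m E Q₁ Q₂ P₁ P₂ : ℝ) : ℝ :=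
  1 / (16 * m) * (P₁ ^ 2 * Q₂ ^ 2 + P₂ ^ 2 * Q₁ ^ 2)
    - √2 * m ^ 2 * (Q₁ ^ 2 + Q₂ ^ 2)
    - √2 * m ^ 2 * (Q₁ ^ 2 * Q₂ ^ 2) / √(Q₁ ^ 4 + Q₂ ^ 4)
    - Q₁ ^ 2 * Q₂ ^ 2 * E

/-- The component `- ∂Γ/∂Q₁` of the Hamiltonian vector field of `Γ`. By the symmetry of `Γ` under
the exchange of the indices, `- ∂Γ/∂Q₂` is `regularizedForce m E Q₂ Q₁ P₁`. -/
noncomputable def regularizedForce (m E Q₁ Q₂ P₂ : ℝ) : ℝ :=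
  -(1 / (8 * m)) * P₂ ^ 2 * Q₁
    + 2 * √2 * m ^ 2 * Q₁
    + 2 * √2 * m ^ 2 * Q₁ * Q₂ ^ 2 / √(Q₁ ^ 4 + Q₂ ^ 4)
    - 2 * √2 * m ^ 2 * Q₁ ^ 5 * Q₂ ^ 2 / √(Q₁ ^ 4 + Q₂ ^ 4) ^ 3
    + 2 * E * Q₁ * Q₂ ^ 2

/-- `(Q₁, Q₂, P₁, P₂)`, as functions of the regularized time `s`, solve Hamilton's equations of the
regularized Hamiltonian, on its zero level, for all `s`. -/
structure SolvesRegularizedEquations (m E : ℝ) (Q₁ Q₂ P₁ P₂ : ℝ → ℝ) : Prop where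
  hQ₁ : ∀ s, HasDerivAt Q₁ (1 / (8 * m) * P₁ s * Q₂ s ^ 2) s
  hQ₂ : ∀ s, HasDerivAt Q₂ (1 / (8 * m) * P₂ s * Q₁ s ^ 2) s
  hP₁ : ∀ s, HasDerivAt P₁ (regularizedForce m E (Q₁ s) (Q₂ s) (P₂ s)) s
  hP₂ : ∀ s, HasDerivAt P₂ (regularizedForce m E (Q₂ s) (Q₁ s) (P₁ s)) s
  level : ∀ s, regularizedHamiltonian m E (Q₁ s) (Q₂ s) (P₁ s) (P₂ s) = 0

/-- The motion `x` of four equal masses `m`, a function of physical time `t`, is a symmetric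
solution of the planar four-body problem of energy `E` in the regularized sense: it solves Newton's
equations off the collisions, its only collisions are SBCs, and with respect to the regularized
time `s`, where `t = τ s` and `dt/ds = Q₁² Q₂² = (x₁ - x₂)(x₁ + x₂)`, it comes from a solution of
the regularized equations, which passes through the collisions. -/
structure IsRegularizedSolution (m E : ℝ) (x : Fin 4 → ℝ → Plane)
    (τ Q₁ Q₂ P₁ P₂ : ℝ → ℝ) : Prop where
  continuous : ∀ i, Continuous (x i)
  newton : SolvesNewtonOffCollisions (fun _ => m) x
  energy : HasEnergyOffCollisions (fun _ => m) x E
  symmetric : ∀ t, IsSymmetricConfiguration (fun i => x i t)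
  collisions : ∀ t, ¬ CollisionFree (fun i => x i t) → IsSBC (fun i => x i t)
  regularized : SolvesRegularizedEquations m E Q₁ Q₂ P₁ P₂
  clock_zero : τ 0 = 0
  clock_deriv : ∀ s, HasDerivAt τ (Q₁ s ^ 2 * Q₂ s ^ 2) s
  clock_strictMono : StrictMono τ
  clock_surjective : Function.Surjective τ
  pos₁ : ∀ s, x 0 (τ s) 0 - x 0 (τ s) 1 = Q₁ s ^ 2
  pos₂ : ∀ s, x 0 (τ s) 0 + x 0 (τ s) 1 = Q₂ s ^ 2
  mom₁ : ∀ s, CollisionFree (fun i => x i (τ s)) →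
    P₁ s = 2 * Q₁ s * (2 * m * (deriv (x 0) (τ s) 0 - deriv (x 0) (τ s) 1))
  mom₂ : ∀ s, CollisionFree (fun i => x i (τ s)) →
    P₂ s = 2 * Q₂ s * (2 * m * (deriv (x 0) (τ s) 0 + deriv (x 0) (τ s) 1))

/-- At time `0` the bodies are at `(r, 0)`, `(0, r)`, `(-r, 0)`, `(0, -r)` and have the velocities
`(0, v)`, `(v, 0)`, `(0, -v)`, `(-v, 0)`. -/
structure StartsAt (r v : ℝ) (x : Fin 4 → ℝ → Plane) : Prop where
  pos : (fun i => x i 0) = ![!₂[r, 0], !₂[0, r], !₂[-r, 0], !₂[0, -r]]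
  vel : (fun i => deriv (x i) 0) = ![!₂[0, v], !₂[v, 0], !₂[0, -v], !₂[-v, 0]]

/-- There is a symmetric periodic orbit with SBC of four equal masses `m`, of total energy `E`,
starting from the square of radius `r` with speed `v`, whose period in regularized time is four
times the time `s₀` of the first collision. -/
def HasSymmetricPeriodicSBCOrbit (m E r v : ℝ) : Prop :=
  ∃ (x : Fin 4 → ℝ → Plane) (τ Q₁ Q₂ P₁ P₂ : ℝ → ℝ) (s₀ : ℝ),
    IsRegularizedSolution m E x τ Q₁ Q₂ P₁ P₂ ∧
    StartsAt r v x ∧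
    -- `s₀` is the time of the first collision
    0 < s₀ ∧ IsLeast {s : ℝ | 0 ≤ s ∧ ¬ CollisionFree (fun i => x i (τ s))} s₀ ∧
    -- each body alternates between collisions with its two neighbours
    (∀ s, x 0 (τ s) = x 1 (τ s) ↔ ∃ k : ℤ, s = s₀ + 4 * s₀ * k) ∧
    (∀ s, x 0 (τ s) = x 3 (τ s) ↔ ∃ k : ℤ, s = 3 * s₀ + 4 * s₀ * k) ∧
    -- time-reversing symmetry about the first collision, reflection symmetry after half a period
    (∀ i s, x i (τ (2 * s₀ - s)) = x i (τ s)) ∧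
    (∀ s, x 0 (τ (s + 2 * s₀)) = !₂[x 0 (τ s) 0, - x 0 (τ s) 1]) ∧
    -- positions and velocities have period `4 s₀` in regularized time
    (∀ i, Function.Periodic (fun s => x i (τ s)) (4 * s₀)) ∧
    (∀ i, Function.Periodic (fun s => deriv (x i) (τ s)) (4 * s₀)) ∧
    -- the motion is periodic in physical time
    (∀ i, Function.Periodic (x i) (τ (4 * s₀)))

/-! With u = Q² = x₁ - x₂ and w = x₁ + x₂ the symmetric problem has two degrees of freedom. In
normalized units the motion starts from the unit square with u falling and w growing, both at the
rate 2p. The proof shoots in `p`: it seeks a speed at which bodies 1 and 2 collide (Q = 0) exactly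
when the velocity V of w vanishes.

An arc is followed until Q or V vanishes. Attraction keeps u falling, and the energy relation then
bounds y away from 0, so every arc ends within regularized time 23 (`y_le_neg`, `b_le`). For p =
1/13 the zero of V comes first (`Q_end_pos`), for p = 2 the collision does (`V_end_pos`). Both zeros
are crossed with nonzero derivative, so the two alternatives are disjoint open conditions on p;
without a simultaneous zero they would disconnect [1/13, 2] (`exists_shootingArc`).

At a simultaneous zero the phase point is fixed by a time-reversing reflection. The orbit therefore
continues through the collision as its own mirror image, and reaches at time 2b the image of its
starting point under a symmetry of order four, which extends it to all times
(`exists_normalizedOrbit`). The energy is negative by a Lagrange–Jacobi argument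
(`startEnergy_neg`). Scaling yields every mass and every negative energy (`exists_rescaled`), and
inverting the clock ∫ Q₁² Q₂² ds gives the physical motion (`hasSymmetricPeriodicSBCOrbit`). -/

open Set Metric Filter Topology
open scoped NNReal

/-! ### Flows of vector fields truncated to a box -/

/-- The coordinatewise projection onto the box `Icc lo hi`. -/
noncomputable def boxProj {n : ℕ} (lo hi x : Fin n → ℝ) : Fin n → ℝ :=
  fun i => max (lo i) (min (hi i) (x i))

theorem boxProj_mem {n : ℕ} {lo hi : Fin n → ℝ} (h : lo ≤ hi) (x : Fin n → ℝ) :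
    boxProj lo hi x ∈ Icc lo hi :=
  ⟨fun _ => le_max_left _ _, fun i => max_le (h i) (min_le_left _ _)⟩

theorem boxProj_apply_of_mem {n : ℕ} {lo hi x : Fin n → ℝ} {i : Fin n} (h₁ : lo i ≤ x i)
    (h₂ : x i ≤ hi i) : boxProj lo hi x i = x i := by
  simp [boxProj, h₁, h₂]

theorem lipschitzWith_boxProj {n : ℕ} (lo hi : Fin n → ℝ) : LipschitzWith 1 (boxProj lo hi) := by
  refine LipschitzWith.of_dist_le_mul fun x y => ?_
  rw [NNReal.coe_one, one_mul, dist_pi_le_iff dist_nonneg]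
  intro i
  have h : LipschitzWith 1 fun a : ℝ => max (lo i) (min (hi i) a) :=
    (LipschitzWith.id.const_min (hi i)).const_max (lo i)
  calc dist (boxProj lo hi x i) (boxProj lo hi y i) ≤ (1 : ℝ≥0) * dist (x i) (y i) :=
        h.dist_le_mul (x i) (y i)
    _ ≤ dist x y := by simpa using dist_le_pi_dist x y i

/-- A `C¹` vector field on a box, extended by the projection onto the box, has a continuous flow on
every ball and every compact interval of times. -/
theorem exists_continuousOn_flow_boxProj {n : ℕ} {lo hi : Fin n → ℝ} (h : lo ≤ hi)
    {F : (Fin n → ℝ) → Fin n → ℝ} (hF : ContDiffOn ℝ 1 F (Icc lo hi)) (R : ℝ≥0) {T : ℝ}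
    (hT : 0 ≤ T) :
    ∃ α : (Fin n → ℝ) × ℝ → Fin n → ℝ, (∀ x ∈ closedBall 0 (R : ℝ), α (x, 0) = x ∧
      ∀ t ∈ Icc (-T) T,
        HasDerivWithinAt (fun s => α (x, s)) (F (boxProj lo hi (α (x, t)))) (Icc (-T) T) t) ∧
      ContinuousOn α (closedBall 0 (R : ℝ) ×ˢ Icc (-T) T) := by
  obtain ⟨K, hK⟩ := (hF.locallyLipschitzOn (convex_Icc lo hi)).exists_lipschitzOnWith_of_compact
    isCompact_Icc
  have hlip : LipschitzWith (K * 1) (F ∘ boxProj lo hi) := by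
    rw [← lipschitzOnWith_univ]
    exact hK.comp (lipschitzWith_boxProj lo hi).lipschitzOnWith fun x _ => boxProj_mem h x
  obtain ⟨L, hL⟩ := isCompact_Icc.exists_bound_of_continuousOn hF.continuousOn
  have hb : ∀ x, ‖(F ∘ boxProj lo hi) x‖ ≤ (L.toNNReal : ℝ) := fun x =>
    (hL _ (boxProj_mem h x)).trans (Real.le_coe_toNNReal L)
  -- The truncated field is bounded by L everywhere, so a solution from the ball of radius R moves
  -- by at most L T; the radius R + L T therefore allows any T.
  have hpl : IsPicardLindelof (fun _ => F ∘ boxProj lo hi) (tmin := -T) (tmax := T)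
      ⟨0, by simpa using hT, hT⟩ 0 (R + L.toNNReal * T.toNNReal) R L.toNNReal (K * 1) := by
    refine IsPicardLindelof.of_time_independent (fun x _ => hb x) hlip.lipschitzOnWith ?_
    simp [Real.coe_toNNReal T hT]
  exact hpl.exists_forall_mem_closedBall_eq_hasDerivWithinAt_continuousOn

theorem monotoneOn_Icc_of_hasDerivAt {f f' : ℝ → ℝ} {a b : ℝ} (hf : ContinuousOn f (Icc a b))
    (hd : ∀ s ∈ Ioo a b, HasDerivAt f (f' s) s) (h₀ : ∀ s ∈ Ioo a b, 0 ≤ f' s) :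
    MonotoneOn f (Icc a b) := by
  refine monotoneOn_of_hasDerivWithinAt_nonneg (convex_Icc a b) hf (f' := f') ?_ ?_ <;>
    rw [interior_Icc]
  exacts [fun s hs => (hd s hs).hasDerivWithinAt, h₀]

theorem antitoneOn_Icc_of_hasDerivAt {f f' : ℝ → ℝ} {a b : ℝ} (hf : ContinuousOn f (Icc a b))
    (hd : ∀ s ∈ Ioo a b, HasDerivAt f (f' s) s) (h₀ : ∀ s ∈ Ioo a b, f' s ≤ 0) :
    AntitoneOn f (Icc a b) := by
  refine antitoneOn_of_hasDerivWithinAt_nonpos (convex_Icc a b) hf (f' := f') ?_ ?_ <;>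
    rw [interior_Icc]
  exacts [fun s hs => (hd s hs).hasDerivWithinAt, h₀]

/-! ### Extension of curves by a linear symmetry -/

/-- The extension of a function on `[0, L]` by a linear symmetry `σ`, so that the extension takes
`s + L` to the image of `s` under `σ`. -/
noncomputable def equivariantExtension {E : Type*} [NormedAddCommGroup E] [NormedSpace ℝ E]
    (σ : E ≃L[ℝ] E) (L : ℝ) (f : ℝ → E) (s : ℝ) : E :=
  (σ ^ ⌊s / L⌋) (f (s - ⌊s / L⌋ * L))

section Extension

variable {E : Type*} [NormedAddCommGroup E] [NormedSpace ℝ E] {σ : E ≃L[ℝ] E} {L : ℝ} {f : ℝ → E}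

theorem equivariantExtension_of_mem_Ico (hL : 0 < L) {s : ℝ} (k : ℤ)
    (hs : s ∈ Ico (k * L) ((k + 1) * L)) :
    equivariantExtension σ L f s = (σ ^ k) (f (s - k * L)) := by
  have : ⌊s / L⌋ = k := by
    rw [Int.floor_eq_iff, le_div_iff₀ hL, div_lt_iff₀ hL]
    exact hs
  rw [equivariantExtension, this]

/-- At the right endpoint the floor has already jumped to k + 1; the two formulas agree there
because f L = σ (f 0). -/
theorem equivariantExtension_of_mem_Icc (hL : 0 < L) (hf : f L = σ (f 0)) {s : ℝ} (k : ℤ)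
    (hs : s ∈ Icc (k * L) ((k + 1) * L)) :
    equivariantExtension σ L f s = (σ ^ k) (f (s - k * L)) := by
  rcases hs.2.lt_or_eq with h | h
  · exact equivariantExtension_of_mem_Ico hL k ⟨hs.1, h⟩
  · rw [equivariantExtension_of_mem_Ico hL (k + 1) (by subst h; push_cast; constructor <;> linarith),
      h, show ((k : ℝ) + 1) * L - k * L = L by ring, hf, zpow_add_one]
    push_cast
    rw [sub_self]
    rfl

theorem equivariantExtension_add (hL : 0 < L) (s : ℝ) :
    equivariantExtension σ L f (s + L) = σ (equivariantExtension σ L f s) := by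
  have : ⌊(s + L) / L⌋ = ⌊s / L⌋ + 1 := by
    rw [add_div, div_self hL.ne', Int.floor_add_one]
  rw [equivariantExtension, equivariantExtension, this, zpow_add, zpow_one,
    (Commute.zpow_self σ _).eq]
  push_cast
  rw [show s + L - (⌊s / L⌋ + 1) * L = s - ⌊s / L⌋ * L by ring]
  rfl

/-- The extension of an integral curve of a vector field by a symmetry of the field. -/
theorem hasDerivAt_equivariantExtension (hL : 0 < L) (hf : f L = σ (f 0)) {X : E → E}
    (hX : ∀ z, X (σ z) = σ (X z))
    (hd : ∀ s ∈ Icc 0 L, HasDerivWithinAt f (X (f s)) (Icc 0 L) s) (s : ℝ) :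
    HasDerivAt (equivariantExtension σ L f) (X (equivariantExtension σ L f s)) s := by
  have hXk : ∀ (k : ℤ) z, X ((σ ^ k) z) = (σ ^ k) (X z) := by
    have hinv : ∀ z, X (σ⁻¹ z) = σ⁻¹ (X z) := fun z => by
      have := hX (σ⁻¹ z)
      have h1 : ∀ w, σ (σ⁻¹ w) = w := fun w => σ.apply_symm_apply w
      have h2 : ∀ w, σ⁻¹ (σ w) = w := fun w => σ.symm_apply_apply w
      rw [h1] at this
      rw [this, h2]
    intro k
    induction k with
    | zero => intro z; rfl
    | succ n ih => intro z; rw [zpow_add_one]; exact (ih _).trans (congrArg _ (hX z))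
    | pred n ih => intro z; rw [zpow_sub_one]; exact (ih _).trans (congrArg _ (hinv z))
  have key : ∀ (k : ℤ), ∀ s ∈ Icc (k * L) ((k + 1) * L),
      HasDerivWithinAt (equivariantExtension σ L f) (X (equivariantExtension σ L f s))
        (Icc (k * L) ((k + 1) * L)) s := by
    intro k s hs
    have hmem : s - k * L ∈ Icc 0 L := ⟨by linarith [hs.1], by linarith [hs.2]⟩
    have h1 : HasDerivWithinAt (fun u => f (u - k * L)) (X (f (s - k * L)))
        (Icc (k * L) ((k + 1) * L)) s := by
      have := (hd _ hmem).scomp s ((hasDerivWithinAt_id s (Icc (k * L) ((k + 1) * L))).sub_const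
        (k * L)) (fun u hu => mem_Icc.2 ⟨sub_nonneg.2 hu.1, by simp only [id]; linarith [hu.2]⟩)
      rw [one_smul] at this
      exact this
    have h2 := (σ ^ k : E ≃L[ℝ] E).toContinuousLinearMap.hasFDerivAt.comp_hasDerivWithinAt s h1
    rw [equivariantExtension_of_mem_Icc hL hf k hs, hXk]
    exact h2.congr (fun u hu => equivariantExtension_of_mem_Icc hL hf k hu)
      (equivariantExtension_of_mem_Icc hL hf k hs)
  have h1 : (⌊s / L⌋ : ℝ) * L ≤ s := (le_div_iff₀ hL).1 (Int.floor_le _)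
  have h2 : s < (⌊s / L⌋ + 1) * L := (div_lt_iff₀ hL).1 (Int.lt_floor_add_one _)
  rcases h1.lt_or_eq with h | h
  · exact (key _ s ⟨h1, h2.le⟩).hasDerivAt (Icc_mem_nhds h h2)
  -- At a multiple of L the two adjacent pieces give one-sided derivatives, both equal to the field
  -- at the same point.
  · have hr := key _ s ⟨h1, h2.le⟩
    have hl := key (⌊s / L⌋ - 1) s (by push_cast; constructor <;> linarith)
    push_cast at hl
    rw [sub_add_cancel] at hl
    rw [h] at hr hl
    have := hl.union hr
    rw [Icc_union_Icc_eq_Icc (by linarith) (by linarith)] at this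
    exact this.hasDerivAt (Icc_mem_nhds (by linarith) (by linarith))

end Extension

/-- A property which is invariant under a translation of `ℝ` holds everywhere if it holds on a
fundamental interval. -/
theorem forall_of_forall_mem_Icc {P : ℝ → Prop} {L : ℝ} (hL : 0 < L) (hP : ∀ s, P (s + L) ↔ P s)
    (h : ∀ s ∈ Icc 0 L, P s) (s : ℝ) : P s := by
  have hk : ∀ (k : ℤ) s, P (s + k * L) ↔ P s := by
    intro k
    induction k with
    | zero => simp
    | succ n ih =>
      intro s
      rw [← ih s, ← hP (s + (n : ℤ) * L)]
      push_cast
      ring_nf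
    | pred n ih =>
      intro s
      rw [← ih s, ← hP (s + ((-n - 1 : ℤ) : ℝ) * L)]
      push_cast
      ring_nf
  have h1 : (⌊s / L⌋ : ℝ) * L ≤ s := (le_div_iff₀ hL).1 (Int.floor_le _)
  have h2 : s < (⌊s / L⌋ + 1) * L := (div_lt_iff₀ hL).1 (Int.lt_floor_add_one _)
  rw [show s = (s - ⌊s / L⌋ * L) + ⌊s / L⌋ * L by ring, hk]
  exact h _ ⟨by linarith, by linarith⟩

/-! ### Shooting arcs and their a priori estimates -/

/-- The distance from the origin in the plane of `u = Q²` and `w`. -/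
noncomputable def planeRadius (Q w : ℝ) : ℝ :=
  √(Q ^ 4 + w ^ 2)

/-- The energy of the normalized motion that starts from the square of radius `1` with
speed `p`. -/
noncomputable def startEnergy (p : ℝ) : ℝ :=
  2 * p ^ 2 - 2 - 1 / √2

/-- The derivative of `y`, the momentum conjugate to `Q`, in regularized time. -/
noncomputable def binaryForce (e Q w V : ℝ) : ℝ :=
  w * (Q * (e + 1 / w + 1 / planeRadius Q w - V ^ 2 / 4) - Q ^ 5 / planeRadius Q w ^ 3)

/-- The derivative in regularized time of the physical velocity `V` of `w`. -/
noncomputable def transverseForce (Q w : ℝ) : ℝ :=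
  -2 * Q ^ 2 * (1 / w + w ^ 2 / planeRadius Q w ^ 3)

/-- An arc, over the interval `[0, b]` of regularized time, of the normalized motion that starts
from the square of radius `1` with speed `p`. Here `x₁ - x₂ = Q²`, `x₁ + x₂ = w`, `V` is the
physical velocity of `w`, and up to the end there is neither a collision nor a zero of `V`. -/
structure IsShootingArc (p b : ℝ) (Q y w V : ℝ → ℝ) : Prop where
  b_pos : 0 < b
  Q_zero : Q 0 = 1
  y_zero : y 0 = -p
  w_zero : w 0 = 1
  V_zero : V 0 = 2 * p
  hQ : ∀ s ∈ Icc 0 b, HasDerivAt Q (y s * w s) s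
  hy : ∀ s ∈ Icc 0 b, HasDerivAt y (binaryForce (startEnergy p) (Q s) (w s) (V s)) s
  hw : ∀ s ∈ Icc 0 b, HasDerivAt w (Q s ^ 2 * w s * V s) s
  hV : ∀ s ∈ Icc 0 b, HasDerivAt V (transverseForce (Q s) (w s)) s
  Q_pos : ∀ s ∈ Ico 0 b, 0 < Q s
  V_pos : ∀ s ∈ Ico 0 b, 0 < V s
  one_le_w : ∀ s ∈ Icc 0 b, 1 ≤ w s

theorem planeRadius_sq (Q w : ℝ) : planeRadius Q w ^ 2 = Q ^ 4 + w ^ 2 :=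
  Real.sq_sqrt (by positivity)

theorem le_planeRadius (Q w : ℝ) : w ≤ planeRadius Q w :=
  Real.le_sqrt_of_sq_le (by nlinarith [sq_nonneg (Q ^ 2)])

theorem planeRadius_pos (Q : ℝ) {w : ℝ} (hw : 0 < w) : 0 < planeRadius Q w :=
  hw.trans_le (le_planeRadius Q w)

theorem one_div_planeRadius_le (Q : ℝ) {w : ℝ} (hw : 1 ≤ w) : 1 / planeRadius Q w ≤ 1 := by
  have := le_planeRadius Q w
  rw [div_le_one (by linarith)]
  linarith

theorem transverseForce_nonpos (Q : ℝ) {w : ℝ} (hw : 0 < w) : transverseForce Q w ≤ 0 := by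
  have := planeRadius_pos Q hw
  have h : 0 ≤ 2 * Q ^ 2 * (1 / w + w ^ 2 / planeRadius Q w ^ 3) := by positivity
  rw [transverseForce]
  linarith

theorem HasDerivAt.one_div_planeRadius {Q w : ℝ → ℝ} {Q' w' s : ℝ} (hQ : HasDerivAt Q Q' s)
    (hw : HasDerivAt w w' s) (hpos : 0 < w s) :
    HasDerivAt (fun s => 1 / planeRadius (Q s) (w s))
      (-(2 * Q s ^ 3 * Q' + w s * w') / planeRadius (Q s) (w s) ^ 3) s := by
  have hR := planeRadius_pos (Q s) hpos
  have h1 : HasDerivAt (fun s => planeRadius (Q s) (w s))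
      ((4 * Q s ^ 3 * Q' + 2 * w s * w') / (2 * planeRadius (Q s) (w s))) s := by
    have := ((hQ.pow 4).add (hw.pow 2)).sqrt (by simp only [Pi.add_apply, Pi.pow_apply]; positivity)
    refine this.congr_deriv ?_
    simp [planeRadius]
  have h2 := h1.inv hR.ne'
  simp only [one_div]
  refine h2.congr_deriv ?_
  field_simp
  ring

theorem inv_sqrt_two_bounds : (0 : ℝ) < 1 / √2 ∧ 1 / √2 < (1 : ℝ) := by
  constructor
  · positivity
  · rw [div_lt_one (by positivity)]
    exact Real.lt_sqrt_of_sq_lt (by norm_num)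

theorem nonneg_on_Icc_of_Ico {f : ℝ → ℝ} {b : ℝ} (hb : 0 < b) (hf : ContinuousOn f (Icc 0 b))
    (hpos : ∀ s ∈ Ico 0 b, 0 ≤ f s) : ∀ s ∈ Icc 0 b, 0 ≤ f s := by
  have : closure (Ico 0 b) = Icc 0 b := closure_Ico hb.ne
  rw [← this] at hf ⊢
  exact fun s hs => le_on_closure hpos continuousOn_const hf hs

namespace IsShootingArc

variable {p b : ℝ} {Q y w V : ℝ → ℝ}

theorem zero_mem (h : IsShootingArc p b Q y w V) : (0 : ℝ) ∈ Icc 0 b := left_mem_Icc.2 h.b_pos.le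

theorem end_mem (h : IsShootingArc p b Q y w V) : b ∈ Icc 0 b := right_mem_Icc.2 h.b_pos.le

theorem contQ (h : IsShootingArc p b Q y w V) : ContinuousOn Q (Icc 0 b) :=
  fun s hs => (h.hQ s hs).continuousAt.continuousWithinAt

theorem conty (h : IsShootingArc p b Q y w V) : ContinuousOn y (Icc 0 b) :=
  fun s hs => (h.hy s hs).continuousAt.continuousWithinAt

theorem contV (h : IsShootingArc p b Q y w V) : ContinuousOn V (Icc 0 b) :=
  fun s hs => (h.hV s hs).continuousAt.continuousWithinAt

theorem Q_nonneg (h : IsShootingArc p b Q y w V) : ∀ s ∈ Icc 0 b, 0 ≤ Q s :=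
  nonneg_on_Icc_of_Ico h.b_pos h.contQ fun s hs => (h.Q_pos s hs).le

theorem V_nonneg (h : IsShootingArc p b Q y w V) : ∀ s ∈ Icc 0 b, 0 ≤ V s :=
  nonneg_on_Icc_of_Ico h.b_pos h.contV fun s hs => (h.V_pos s hs).le

theorem w_pos (h : IsShootingArc p b Q y w V) {s : ℝ} (hs : s ∈ Icc 0 b) : 0 < w s :=
  zero_lt_one.trans_le (h.one_le_w s hs)

theorem V_le (h : IsShootingArc p b Q y w V) : ∀ s ∈ Icc 0 b, V s ≤ 2 * p := by
  intro s hs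
  rw [← h.V_zero]
  exact antitoneOn_Icc_of_hasDerivAt h.contV (fun s hs => h.hV s (Ioo_subset_Icc_self hs))
    (fun s hs => transverseForce_nonpos _ (h.w_pos (Ioo_subset_Icc_self hs))) h.zero_mem hs hs.1

/-- Conservation of energy multiplied by Q²: since the physical velocity of Q² is 2y/Q, the singular
terms become y² and 1. At a collision the relation reads y² = 1. -/
theorem energy (h : IsShootingArc p b Q y w V) : ∀ s ∈ Icc 0 b,
    y s ^ 2 = 1 + Q s ^ 2 * (startEnergy p + 1 / w s + 1 / planeRadius (Q s) (w s)
      - V s ^ 2 / 4) := by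
  let G : ℝ → ℝ := fun s => y s ^ 2 - Q s ^ 2 * (startEnergy p + (w s)⁻¹
    + 1 / planeRadius (Q s) (w s) - V s ^ 2 / 4)
  have hG : ∀ s ∈ Icc 0 b, HasDerivAt G 0 s := by
    intro s hs
    have hw0 := h.w_pos hs
    have hR := planeRadius_pos (Q s) hw0
    have hQ := h.hQ s hs
    have hw := h.hw s hs
    have hV := h.hV s hs
    have := ((h.hy s hs).pow 2).sub ((hQ.pow 2).mul ((((hw.inv hw0.ne').const_add
      (startEnergy p)).add (hQ.one_div_planeRadius hw hw0)).sub ((hV.pow 2).div_const 4)))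
    refine this.congr_deriv ?_
    simp only [binaryForce, transverseForce, Pi.add_apply, Pi.sub_apply, Pi.pow_apply, Pi.inv_apply]
    generalize planeRadius (Q s) (w s) = R at *
    generalize startEnergy p = e at *
    push_cast
    field_simp
    ring
  intro s hs
  have hc : G s = G 0 := by
    have h1 := monotoneOn_Icc_of_hasDerivAt (f' := 0)
      (fun s hs => (hG s hs).continuousAt.continuousWithinAt)
      (fun s hs => hG s (Ioo_subset_Icc_self hs)) (fun s _ => le_rfl) h.zero_mem hs hs.1
    have h2 := antitoneOn_Icc_of_hasDerivAt (f' := 0)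
      (fun s hs => (hG s hs).continuousAt.continuousWithinAt)
      (fun s hs => hG s (Ioo_subset_Icc_self hs)) (fun s _ => le_rfl) h.zero_mem hs hs.1
    exact le_antisymm h2 h1
  have h0 : G 0 = 1 := by
    simp only [G, h.Q_zero, h.y_zero, h.w_zero, h.V_zero, planeRadius, startEnergy]
    norm_num
    ring
  rw [h0] at hc
  simp only [G] at hc
  rw [one_div (w s)]
  linarith

/-- The quotient y/Q is half the physical velocity of Q², and it decreases because all forces
attract: by the energy relation its derivative is -w(1 + Q⁶/R³)/Q², where R is the plane radius. -/
theorem y_le (h : IsShootingArc p b Q y w V) : ∀ s ∈ Icc 0 b, y s ≤ -p * Q s := by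
  have hIco : ∀ s ∈ Ico 0 b, 0 ≤ -p * Q s - y s := by
    intro c hc
    have hsub : ∀ s ∈ Icc 0 c, s ∈ Icc 0 b := fun s hs => ⟨hs.1, hs.2.trans hc.2.le⟩
    have hpos : ∀ s ∈ Icc 0 c, 0 < Q s := fun s hs => h.Q_pos s ⟨hs.1, hs.2.trans_lt hc.2⟩
    have hd : ∀ s ∈ Icc 0 c, HasDerivAt (fun s => y s / Q s)
        ((binaryForce (startEnergy p) (Q s) (w s) (V s) * Q s - y s * (y s * w s)) / Q s ^ 2) s :=
      fun s hs => (h.hy s (hsub s hs)).div (h.hQ s (hsub s hs)) (hpos s hs).ne'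
    have := antitoneOn_Icc_of_hasDerivAt (fun s hs => (hd s hs).continuousAt.continuousWithinAt)
      (fun s hs => hd s (Ioo_subset_Icc_self hs)) ?_ (left_mem_Icc.2 hc.1) (right_mem_Icc.2 hc.1)
      hc.1
    · simp only [h.y_zero, h.Q_zero, div_one] at this
      rw [div_le_iff₀ (hpos c (right_mem_Icc.2 hc.1))] at this
      linarith
    · intro s hs
      have hs' := hsub s (Ioo_subset_Icc_self hs)
      have hQ := hpos s (Ioo_subset_Icc_self hs)
      have hw := h.w_pos hs'
      have hR := planeRadius_pos (Q s) hw
      refine div_nonpos_of_nonpos_of_nonneg ?_ (sq_nonneg _)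
      have he := h.energy s hs'
      have : binaryForce (startEnergy p) (Q s) (w s) (V s) * Q s - y s * (y s * w s)
          = -(w s * (1 + Q s ^ 6 / planeRadius (Q s) (w s) ^ 3)) := by
        rw [show y s * (y s * w s) = y s ^ 2 * w s by ring, he, binaryForce]
        ring
      rw [this]
      have : 0 ≤ w s * (1 + Q s ^ 6 / planeRadius (Q s) (w s) ^ 3) := by positivity
      linarith
  intro s hs
  exact sub_nonneg.1 (nonneg_on_Icc_of_Ico h.b_pos ((continuousOn_const.mul h.contQ).sub h.conty)
    hIco s hs)

/-- Near the collision the energy relation forces y² towards 1; elsewhere y ≤ -pQ is effective.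
Since e - V²/4 ≥ p² - 2 - 1/√2 > -3 and Q ≤ 13|y|, one gets y² ≥ 1 - 3Q² ≥ 1 - 507y², hence y² ≥
1/508 > 1/23². -/
theorem y_le_neg (h : IsShootingArc p b Q y w V) (hp : 1 / 13 ≤ p) :
    ∀ s ∈ Icc 0 b, y s ≤ -(1 / 23) := by
  intro s hs
  have hw := h.one_le_w s hs
  have hw0 := h.w_pos hs
  have hR := planeRadius_pos (Q s) hw0
  have hQ := h.Q_nonneg s hs
  have hV : V s ^ 2 ≤ (2 * p) ^ 2 := pow_le_pow_left₀ (h.V_nonneg s hs) (h.V_le s hs) 2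
  have h1 : -3 ≤ startEnergy p + 1 / w s + 1 / planeRadius (Q s) (w s) - V s ^ 2 / 4 := by
    have a : 0 < 1 / w s := by positivity
    have b : 0 < 1 / planeRadius (Q s) (w s) := by positivity
    have := inv_sqrt_two_bounds
    rw [startEnergy]
    nlinarith
  have h2 : y s ^ 2 ≥ 1 - 3 * Q s ^ 2 := by
    rw [h.energy s hs]
    nlinarith [sq_nonneg (Q s)]
  have h3 : Q s ≤ -13 * y s := by
    have := h.y_le s hs
    nlinarith
  by_contra! hcon
  have h4 : Q s ^ 2 ≤ (-13 * y s) ^ 2 := pow_le_pow_left₀ hQ h3 2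
  nlinarith

theorem Q_add_le (h : IsShootingArc p b Q y w V) (hp : 1 / 13 ≤ p) :
    ∀ s ∈ Icc 0 b, Q s + s / 23 ≤ 1 := by
  intro s hs
  have hd : ∀ s ∈ Icc 0 b, HasDerivAt (fun s => Q s + s / 23) (y s * w s + 1 / 23) s :=
    fun s hs => (h.hQ s hs).add ((hasDerivAt_id s).div_const 23)
  have := antitoneOn_Icc_of_hasDerivAt (fun s hs => (hd s hs).continuousAt.continuousWithinAt)
    (fun s hs => hd s (Ioo_subset_Icc_self hs)) (fun s hs => ?_) h.zero_mem hs hs.1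
  · simpa [h.Q_zero] using this
  · have h1 := h.y_le_neg hp s (Ioo_subset_Icc_self hs)
    have h2 := h.one_le_w s (Ioo_subset_Icc_self hs)
    nlinarith

theorem b_le (h : IsShootingArc p b Q y w V) (hp : 1 / 13 ≤ p) : b ≤ 23 := by
  linarith [h.Q_add_le hp b h.end_mem, h.Q_nonneg b h.end_mem]

/-- The sum Q² + w = 2x₁ starts at 2 and decreases: V ≤ 2p, while the physical velocity 2y/Q of Q²
is at most -2p before the collision. -/
theorem w_le_two (h : IsShootingArc p b Q y w V) : ∀ s ∈ Icc 0 b, w s ≤ 2 := by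
  intro s hs
  have hd : ∀ s ∈ Icc 0 b, HasDerivAt (fun s => Q s ^ 2 + w s)
      (Q s * w s * (2 * y s + Q s * V s)) s := fun s hs => by
    refine (((h.hQ s hs).pow 2).add (h.hw s hs)).congr_deriv ?_
    push_cast
    ring
  have := antitoneOn_Icc_of_hasDerivAt (fun s hs => (hd s hs).continuousAt.continuousWithinAt)
    (fun s hs => hd s (Ioo_subset_Icc_self hs)) (fun s hs => ?_) h.zero_mem hs hs.1
  · simp only [h.Q_zero, h.w_zero] at this
    nlinarith [sq_nonneg (Q s)]
  · have hs' := Ioo_subset_Icc_self hs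
    have hQ := h.Q_nonneg s hs'
    refine mul_nonpos_of_nonneg_of_nonpos (mul_nonneg hQ (h.w_pos hs').le) ?_
    nlinarith [h.y_le s hs', h.V_le s hs']

/-- A slow motion does not reach a collision before `V` changes its sign. -/
theorem Q_end_pos (h : IsShootingArc (1 / 13) b Q y w V) : 0 < Q b := by
  -- This function decreases: V falls at a rate of at least Q², and Q³/6 at a rate of at most Q²
  -- because -1 ≤ y and w ≤ 2. It starts at 2/13 - 1/6 < 0, so Q b = 0 would make V b negative.
  have hd : ∀ s ∈ Icc 0 b, HasDerivAt (fun s => V s - Q s ^ 3 / 6)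
      (transverseForce (Q s) (w s) - Q s ^ 2 * (y s * w s) / 2) s := fun s hs => by
    refine ((h.hV s hs).sub (((h.hQ s hs).pow 3).div_const 6)).congr_deriv ?_
    push_cast
    ring
  have := antitoneOn_Icc_of_hasDerivAt (fun s hs => (hd s hs).continuousAt.continuousWithinAt)
    (fun s hs => hd s (Ioo_subset_Icc_self hs)) (fun s hs => ?_) h.zero_mem h.end_mem h.b_pos.le
  · simp only [h.Q_zero, h.V_zero] at this
    have hV := h.V_nonneg b h.end_mem
    have h0 := h.Q_nonneg b h.end_mem
    rcases h0.lt_or_eq with h1 | h1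
    · exact h1
    · rw [← h1] at this
      norm_num at this
      linarith
  · have hs' := Ioo_subset_Icc_self hs
    have hw := h.one_le_w s hs'
    have hw0 := h.w_pos hs'
    have hw2 := h.w_le_two s hs'
    have hR := planeRadius_pos (Q s) hw0
    have hy : -1 ≤ y s := by
      have he := h.energy s hs'
      have h1 : startEnergy (1 / 13) + 1 / w s + 1 / planeRadius (Q s) (w s) - V s ^ 2 / 4 ≤ 0 := by
        have a : 1 / w s ≤ 1 := by rw [div_le_one hw0]; exact hw
        have b := one_div_planeRadius_le (Q s) hw
        have c : (1 / 2 : ℝ) ≤ 1 / √2 := by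
          apply one_div_le_one_div_of_le (by positivity)
          exact Real.sqrt_le_iff.2 (by norm_num)
        rw [startEnergy]
        nlinarith [sq_nonneg (V s)]
      have h2 := mul_nonpos_of_nonneg_of_nonpos (sq_nonneg (Q s)) h1
      nlinarith
    have hf : transverseForce (Q s) (w s) ≤ - Q s ^ 2 := by
      have a : 1 / 2 ≤ 1 / w s := one_div_le_one_div_of_le hw0 hw2
      have b : 0 ≤ w s ^ 2 / planeRadius (Q s) (w s) ^ 3 := by positivity
      rw [transverseForce]
      nlinarith [sq_nonneg (Q s)]
    nlinarith [sq_nonneg (Q s), mul_nonneg (sq_nonneg (Q s)) (show 0 ≤ 2 + y s * w s by nlinarith)]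

/-- A fast motion reaches a collision before `V` changes its sign. -/
theorem V_end_pos (h : IsShootingArc 2 b Q y w V) : 0 < V b := by
  -- This function increases from 4 - 1 = 3: V falls at a rate of at most 4Q², and Q² falls at least
  -- that fast because y ≤ -2Q and w ≥ 1.
  have hd : ∀ s ∈ Icc 0 b, HasDerivAt (fun s => V s - Q s ^ 2)
      (transverseForce (Q s) (w s) - 2 * Q s * (y s * w s)) s := fun s hs => by
    refine ((h.hV s hs).sub ((h.hQ s hs).pow 2)).congr_deriv ?_
    push_cast
    ring
  have := monotoneOn_Icc_of_hasDerivAt (fun s hs => (hd s hs).continuousAt.continuousWithinAt)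
    (fun s hs => hd s (Ioo_subset_Icc_self hs)) (fun s hs => ?_) h.zero_mem h.end_mem h.b_pos.le
  · simp only [h.Q_zero, h.V_zero] at this
    nlinarith [sq_nonneg (Q b)]
  · have hs' := Ioo_subset_Icc_self hs
    have hw := h.one_le_w s hs'
    have hw0 := h.w_pos hs'
    have hR := le_planeRadius (Q s) (w s)
    have hR0 := planeRadius_pos (Q s) hw0
    have hQ := h.Q_nonneg s hs'
    have hy := h.y_le s hs'
    have a : 1 / w s ≤ 1 := by rw [div_le_one hw0]; exact hw
    have b : w s ^ 2 / planeRadius (Q s) (w s) ^ 3 ≤ 1 := by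
      rw [div_le_one (by positivity)]
      calc w s ^ 2 ≤ planeRadius (Q s) (w s) ^ 2 := pow_le_pow_left₀ hw0.le hR 2
        _ ≤ planeRadius (Q s) (w s) ^ 3 := pow_le_pow_right₀ (hw.trans hR) (by norm_num)
    have hf : -(4 * Q s ^ 2) ≤ transverseForce (Q s) (w s) := by
      rw [transverseForce]
      nlinarith [sq_nonneg (Q s)]
    have hg : 2 * Q s * (y s * w s) ≤ 2 * Q s * (-2 * Q s * 1) := by
      apply mul_le_mul_of_nonneg_left _ (by positivity)
      nlinarith
    nlinarith

/-- If a collision and a zero of `V` happen at the same time, then the energy is negative. -/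
theorem startEnergy_neg (h : IsShootingArc p b Q y w V) (hQb : Q b = 0) (hVb : V b = 0) :
    startEnergy p < 0 := by
  by_contra! he
  -- Lagrange–Jacobi: this is the physical-time derivative of (u² + w²)/2, half the sum of squares
  -- of Q² and w. It vanishes at both ends of the arc, but would increase strictly if e ≥ 0.
  have hd : ∀ s ∈ Icc 0 b, HasDerivAt (fun s => 2 * (Q s * y s) + w s * V s)
      (2 * y s ^ 2 * w s + 2 * startEnergy p * Q s ^ 2 * w s + Q s ^ 2 * w s * V s ^ 2 / 2) s :=
    fun s hs => by
      refine ((((h.hQ s hs).mul (h.hy s hs)).const_mul 2).add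
        ((h.hw s hs).mul (h.hV s hs))).congr_deriv ?_
      have hw0 := h.w_pos hs
      have hR := planeRadius_pos (Q s) hw0
      have hR2 := planeRadius_sq (Q s) (w s)
      simp only [binaryForce, transverseForce]
      generalize planeRadius (Q s) (w s) = R at *
      generalize startEnergy p = e at *
      have : Q s ^ 4 = R ^ 2 - w s ^ 2 := by linarith
      field_simp
      linear_combination (-16 * Q s ^ 2 * w s) * this
  have hlt : (fun s => 2 * (Q s * y s) + w s * V s) 0 < (fun s => 2 * (Q s * y s) + w s * V s) b := by
    refine strictMonoOn_of_deriv_pos (convex_Icc 0 b)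
      (fun s hs => (hd s hs).continuousAt.continuousWithinAt) (fun s hs => ?_) h.zero_mem h.end_mem
      h.b_pos
    rw [interior_Icc] at hs
    have hs' := Ioo_subset_Icc_self hs
    rw [(hd s hs').deriv]
    have hw0 := h.w_pos hs'
    have h1 := h.Q_pos s ⟨hs.1.le, hs.2⟩
    have h2 := h.V_pos s ⟨hs.1.le, hs.2⟩
    positivity
  simp only [h.Q_zero, h.y_zero, h.w_zero, h.V_zero, hQb, hVb] at hlt
  linarith

end IsShootingArc

/-! ### The truncated shooting flow -/

/-- The vector field of the shooting problem, in the coordinates `Q`, `y`, `w`, `V` and the energy,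
which is a constant of the motion. -/
noncomputable def shootingField (z : Fin 5 → ℝ) : Fin 5 → ℝ :=
  ![z 1 * z 2, binaryForce (z 4) (z 0) (z 2) (z 3), z 0 ^ 2 * z 2 * z 3,
    transverseForce (z 0) (z 2), 0]

/-- The lower corner of the box which contains all shooting arcs. -/
noncomputable def boxLo : Fin 5 → ℝ :=
  ![0, -(300 * Real.exp 96), 1, 0, -3]

/-- The upper corner of the box which contains all shooting arcs. -/
noncomputable def boxHi : Fin 5 → ℝ :=
  ![1, 0, Real.exp 96, 4, 6]

theorem boxLo_le_boxHi : boxLo ≤ boxHi := by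
  intro i
  have := Real.exp_pos 96
  fin_cases i <;> simp [boxLo, boxHi] <;> linarith

theorem contDiffOn_shootingField : ContDiffOn ℝ 1 shootingField (Icc boxLo boxHi) := by
  have hc : ∀ i : Fin 5, ContDiffOn ℝ 1 (fun z : Fin 5 → ℝ => z i) (Icc boxLo boxHi) :=
    fun i => (contDiff_apply ℝ ℝ i).contDiffOn
  have hw : ∀ z ∈ Icc boxLo boxHi, 0 < z 2 := fun z hz => by
    have : (1 : ℝ) ≤ z 2 := hz.1 2
    linarith
  have hR : ContDiffOn ℝ 1 (fun z : Fin 5 → ℝ => planeRadius (z 0) (z 2)) (Icc boxLo boxHi) := by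
    refine (((hc 0).pow 4).add ((hc 2).pow 2)).sqrt fun z hz => ?_
    have := hw z hz
    positivity
  have hR0 : ∀ z ∈ Icc boxLo boxHi, planeRadius (z 0) (z 2) ≠ 0 :=
    fun z hz => (planeRadius_pos _ (hw z hz)).ne'
  have hw0 : ∀ z ∈ Icc boxLo boxHi, z 2 ≠ 0 := fun z hz => (hw z hz).ne'
  have hR3 : ∀ z ∈ Icc boxLo boxHi, planeRadius (z 0) (z 2) ^ 3 ≠ 0 :=
    fun z hz => pow_ne_zero 3 (hR0 z hz)
  rw [contDiffOn_pi]
  intro i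
  fin_cases i
  · exact (hc 1).mul (hc 2)
  · exact (hc 2).mul (((hc 0).mul ((((hc 4).add (contDiffOn_const.div (hc 2) hw0)).add
      (contDiffOn_const.div hR hR0)).sub (((hc 3).pow 2).div_const 4))).sub
      (((hc 0).pow 5).div (hR.pow 3) hR3))
  · exact (((hc 0).pow 2).mul (hc 2)).mul (hc 3)
  · exact (contDiffOn_const.mul ((hc 0).pow 2)).mul ((contDiffOn_const.div (hc 2) hw0).add
      (((hc 2).pow 2).div (hR.pow 3) hR3))
  · exact contDiffOn_const

/-- The initial values of the shooting problem. -/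
noncomputable def shootingStart (p : ℝ) : Fin 5 → ℝ :=
  ![1, -p, 1, 2 * p, startEnergy p]

/-- The shooting speeds. -/
abbrev shootingSpeeds : Set ℝ := Icc (1 / 13) 2

theorem startEnergy_mem {p : ℝ} (hp : p ∈ shootingSpeeds) : startEnergy p ∈ Icc (-3 : ℝ) 6 := by
  have := inv_sqrt_two_bounds
  rw [startEnergy]
  constructor <;> nlinarith [hp.1, hp.2]

/-- A continuous family of solutions of the shooting problem for the field extended by the
projection onto the box. -/
theorem exists_shooting_family : ∃ α : ℝ → ℝ → Fin 5 → ℝ,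
    ContinuousOn (fun x : ℝ × ℝ => α x.1 x.2) (shootingSpeeds ×ˢ Icc (-24) 24) ∧
    ∀ p ∈ shootingSpeeds, α p 0 = shootingStart p ∧ ∀ s ∈ Ioo (-24 : ℝ) 24, ∀ i,
      HasDerivAt (fun s => α p s i) (shootingField (boxProj boxLo boxHi (α p s)) i) s := by
  -- The sup-norm ball of radius 6 contains all starting points, and T = 24 exceeds the bound 23 for
  -- the length of an arc.
  obtain ⟨α, hα, hc⟩ := exists_continuousOn_flow_boxProj boxLo_le_boxHi contDiffOn_shootingField 6
    (T := 24) (by norm_num)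
  have hst : ∀ p ∈ shootingSpeeds, shootingStart p ∈ closedBall (0 : Fin 5 → ℝ) ((6 : ℝ≥0) : ℝ) := by
    intro p hp
    have he := startEnergy_mem hp
    rw [mem_closedBall_zero_iff, pi_norm_le_iff_of_nonneg (by positivity)]
    intro i
    rw [Real.norm_eq_abs, abs_le]
    have := hp.1
    have := hp.2
    constructor <;> fin_cases i <;> simp [shootingStart] <;> linarith [he.1, he.2]
  refine ⟨fun p s => α (shootingStart p, s), ?_, fun p hp => ⟨(hα _ (hst p hp)).1, ?_⟩⟩
  · refine hc.comp (Continuous.continuousOn ?_) fun x hx => ⟨hst _ hx.1, hx.2⟩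
    refine Continuous.prodMk (continuous_pi fun i => ?_) continuous_snd
    fin_cases i <;> simp [shootingStart, startEnergy] <;> fun_prop
  · intro s hs i
    exact hasDerivAt_pi.1 (((hα _ (hst p hp)).2 s (Ioo_subset_Icc_self hs)).hasDerivAt
      (Icc_mem_nhds hs.1 hs.2)) i

/-- The first zero of a continuous function which is positive at the beginning. -/
theorem exists_first_zero {f : ℝ → ℝ} {b : ℝ} (hf : ContinuousOn f (Icc 0 b)) (h0 : 0 < f 0)
    {s : ℝ} (hs : s ∈ Icc 0 b) (hfs : f s ≤ 0) :
    ∃ c ∈ Ioc 0 b, f c = 0 ∧ ∀ t ∈ Ico 0 c, 0 < f t := by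
  have hcl : IsCompact (Icc 0 b ∩ f ⁻¹' Iic 0) :=
    (isCompact_Icc).of_isClosed_subset (hf.preimage_isClosed_of_isClosed isClosed_Icc isClosed_Iic)
      inter_subset_left
  obtain ⟨c, ⟨hc, hfc⟩, hmin⟩ := hcl.exists_isLeast ⟨s, hs, hfs⟩
  have hpos : ∀ t ∈ Ico 0 c, 0 < f t := fun t ht => by
    by_contra! hcon
    exact absurd (hmin ⟨⟨ht.1, ht.2.le.trans hc.2⟩, hcon⟩) (not_le.2 ht.2)
  have hc0 : 0 < c := by
    rcases hc.1.lt_or_eq with h | h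
    · exact h
    · rw [← h] at hfc
      exact absurd hfc (not_le.2 h0)
  refine ⟨c, ⟨hc0, hc.2⟩, le_antisymm hfc ?_, hpos⟩
  exact nonneg_on_Icc_of_Ico hc0 (hf.mono (Icc_subset_Icc_right hc.2))
    (fun t ht => (hpos t ht).le) c (right_mem_Icc.2 hc0.le)

/-- Up to time b the truncation is inactive. The signs of the truncated field first give the bounds
on e, V, Q and w ≥ 1; then w is bounded above by growth at rate 4; the bound on y comes last, which
is possible since its force does not involve y. -/
theorem isShootingArc_of_neg {p b : ℝ} (hp : p ∈ shootingSpeeds) (hb : b ∈ Ioo (0 : ℝ) 24)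
    {z : ℝ → Fin 5 → ℝ} (hz0 : z 0 = shootingStart p)
    (hz : ∀ s ∈ Ioo (-24 : ℝ) 24, ∀ i,
      HasDerivAt (fun s => z s i) (shootingField (boxProj boxLo boxHi (z s)) i) s)
    (hQ : ∀ s ∈ Ico 0 b, 0 < z s 0) (hV : ∀ s ∈ Ico 0 b, 0 < z s 3)
    (hy : ∀ s ∈ Ico 0 b, z s 1 < 0) :
    IsShootingArc p b (fun s => z s 0) (fun s => z s 1) (fun s => z s 2) (fun s => z s 3) := by
  have hsub : ∀ s ∈ Icc 0 b, s ∈ Ioo (-24 : ℝ) 24 := fun s hs =>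
    ⟨by linarith [hs.1], hs.2.trans_lt hb.2⟩
  have h0 : (0 : ℝ) ∈ Icc 0 b := left_mem_Icc.2 hb.1.le
  have hc : ∀ i, ContinuousOn (fun s => z s i) (Icc 0 b) := fun i s hs =>
    (hz s (hsub s hs) i).continuousAt.continuousWithinAt
  have hd : ∀ i, ∀ s ∈ Ioo 0 b, HasDerivAt (fun s => z s i)
      (shootingField (boxProj boxLo boxHi (z s)) i) s := fun i s hs =>
    hz s (hsub s (Ioo_subset_Icc_self hs)) i
  have hmem := fun s => boxProj_mem boxLo_le_boxHi (z s)
  have hQ0 : ∀ s ∈ Icc 0 b, 0 ≤ z s 0 :=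
    nonneg_on_Icc_of_Ico hb.1 (hc 0) fun s hs => (hQ s hs).le
  have hV0 : ∀ s ∈ Icc 0 b, 0 ≤ z s 3 :=
    nonneg_on_Icc_of_Ico hb.1 (hc 3) fun s hs => (hV s hs).le
  have hy0 : ∀ s ∈ Icc 0 b, z s 1 ≤ 0 := fun s hs => neg_nonneg.1
    (nonneg_on_Icc_of_Ico hb.1 (hc 1).neg (fun s hs => (neg_pos.2 (hy s hs)).le) s hs)
  have hw1 : ∀ s, 1 ≤ boxProj boxLo boxHi (z s) 2 := fun s => (hmem s).1 2
  have he : ∀ s ∈ Icc 0 b, z s 4 = startEnergy p := by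
    intro s hs
    have hst : z 0 4 = startEnergy p := by rw [hz0]; rfl
    rw [← hst]
    exact le_antisymm
      (antitoneOn_Icc_of_hasDerivAt (hc 4) (hd 4) (fun s _ => le_rfl) h0 hs hs.1)
      (monotoneOn_Icc_of_hasDerivAt (hc 4) (hd 4) (fun s _ => le_rfl) h0 hs hs.1)
  have hV4 : ∀ s ∈ Icc 0 b, z s 3 ≤ 4 := by
    intro s hs
    have h1 : z s 3 ≤ z 0 3 := antitoneOn_Icc_of_hasDerivAt (hc 3) (hd 3)
      (fun s _ => transverseForce_nonpos _ (zero_lt_one.trans_le (hw1 s))) h0 hs hs.1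
    have h2 : z 0 3 = 2 * p := by rw [hz0]; rfl
    linarith [hp.2]
  have hQ1 : ∀ s ∈ Icc 0 b, z s 0 ≤ 1 := by
    intro s hs
    have h1 : z s 0 ≤ z 0 0 := antitoneOn_Icc_of_hasDerivAt (hc 0) (hd 0)
      (fun s _ => mul_nonpos_of_nonpos_of_nonneg ((hmem s).2 1) (zero_le_one.trans (hw1 s))) h0 hs
      hs.1
    have h2 : z 0 0 = 1 := by rw [hz0]; rfl
    linarith
  have hw : ∀ s ∈ Icc 0 b, 1 ≤ z s 2 := by
    intro s hs
    have h1 : z 0 2 ≤ z s 2 := monotoneOn_Icc_of_hasDerivAt (hc 2) (hd 2)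
      (fun s _ => mul_nonneg (mul_nonneg (sq_nonneg _) (zero_le_one.trans (hw1 s)))
        ((hmem s).1 3)) h0 hs hs.1
    have h2 : z 0 2 = 1 := by rw [hz0]; rfl
    linarith
  have hwM : ∀ s ∈ Icc 0 b, z s 2 ≤ Real.exp 96 := by
    intro s hs
    -- From Q ≤ 1 and V ≤ 4 follows w' ≤ 4w, hence w ≤ exp (4 · 24).
    have hd' : ∀ s ∈ Ioo 0 b, HasDerivAt (fun s => z s 2 * Real.exp (-4 * s))
        (shootingField (boxProj boxLo boxHi (z s)) 2 * Real.exp (-4 * s)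
          + z s 2 * (Real.exp (-4 * s) * (-4 * 1))) s := fun s hs =>
      (hd 2 s hs).mul ((((hasDerivAt_id s).const_mul (-4)).exp))
    have h1 := antitoneOn_Icc_of_hasDerivAt ((hc 2).mul
      (Continuous.continuousOn (by fun_prop))) hd' (fun s hs => ?_) h0 hs hs.1
    · have h2 : z 0 2 = 1 := by rw [hz0]; rfl
      simp only [Pi.mul_apply, h2, mul_zero, Real.exp_zero, mul_one] at h1
      calc z s 2 = z s 2 * Real.exp (-4 * s) * Real.exp (4 * s) := by
            rw [mul_assoc, ← Real.exp_add]; simp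
        _ ≤ 1 * Real.exp (4 * s) := mul_le_mul_of_nonneg_right h1 (Real.exp_pos _).le
        _ ≤ Real.exp 96 := by
            rw [one_mul]
            exact Real.exp_le_exp.2 (by linarith [hs.2, hb.2])
    · have hs' := Ioo_subset_Icc_self hs
      have hwle : boxProj boxLo boxHi (z s) 2 ≤ z s 2 := max_le (hw s hs') (min_le_right _ _)
      have a1 : boxProj boxLo boxHi (z s) 0 = z s 0 :=
        boxProj_apply_of_mem (hQ0 s hs') (hQ1 s hs')
      have a3 : boxProj boxLo boxHi (z s) 3 = z s 3 :=
        boxProj_apply_of_mem (hV0 s hs') (hV4 s hs')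
      have key : shootingField (boxProj boxLo boxHi (z s)) 2 ≤ z s 2 * 4 := by
        show boxProj boxLo boxHi (z s) 0 ^ 2 * boxProj boxLo boxHi (z s) 2
          * boxProj boxLo boxHi (z s) 3 ≤ _
        rw [a1, a3]
        have b1 : z s 0 ^ 2 ≤ 1 := pow_le_one₀ (hQ0 s hs') (hQ1 s hs')
        have b2 : z s 0 ^ 2 * boxProj boxLo boxHi (z s) 2 ≤ z s 2 := by
          have := mul_le_mul b1 hwle (zero_le_one.trans (hw1 s)) zero_le_one
          linarith
        exact mul_le_mul b2 (hV4 s hs') (hV0 s hs') (by linarith [hw s hs'])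
      nlinarith [Real.exp_pos (-4 * s)]
  have hproj : ∀ i ≠ 1, ∀ s ∈ Icc 0 b, boxProj boxLo boxHi (z s) i = z s i := by
    intro i hi s hs
    have hes := startEnergy_mem hp
    rw [← he s hs] at hes
    fin_cases i
    · exact boxProj_apply_of_mem (hQ0 s hs) (hQ1 s hs)
    · exact absurd rfl hi
    · exact boxProj_apply_of_mem (hw s hs) (hwM s hs)
    · exact boxProj_apply_of_mem (hV0 s hs) (hV4 s hs)
    · exact boxProj_apply_of_mem hes.1 hes.2
  have hforce : ∀ s ∈ Icc 0 b, shootingField (boxProj boxLo boxHi (z s)) 1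
      = binaryForce (startEnergy p) (z s 0) (z s 2) (z s 3) := by
    intro s hs
    show binaryForce (boxProj boxLo boxHi (z s) 4) (boxProj boxLo boxHi (z s) 0)
      (boxProj boxLo boxHi (z s) 2) (boxProj boxLo boxHi (z s) 3) = _
    rw [hproj 4 (by decide) s hs, hproj 0 (by decide) s hs, hproj 2 (by decide) s hs,
      hproj 3 (by decide) s hs, he s hs]
  have hyM : ∀ s ∈ Icc 0 b, -(300 * Real.exp 96) ≤ z s 1 := by
    intro s hs
    -- The factor of w in the force is at least -3 - 4 - 1 = -8, from e, V²/4 and Q⁵/R³. Over time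
    -- 24 this keeps y above -2 - 192 exp 96.
    have hd' : ∀ s ∈ Ioo 0 b, HasDerivAt (fun s => z s 1 + 8 * Real.exp 96 * s)
        (binaryForce (startEnergy p) (z s 0) (z s 2) (z s 3) + 8 * Real.exp 96 * 1) s :=
      fun s hs => by
        rw [← hforce s (Ioo_subset_Icc_self hs)]
        exact (hd 1 s hs).add ((hasDerivAt_id s).const_mul _)
    have h1 := monotoneOn_Icc_of_hasDerivAt ((hc 1).add
      (Continuous.continuousOn (by fun_prop))) hd' (fun s hs => ?_) h0 hs hs.1
    · have h2 : z 0 1 = -p := by rw [hz0]; rfl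
      simp only [Pi.add_apply, h2, mul_zero, add_zero] at h1
      have h3 : (1 : ℝ) ≤ Real.exp 96 := Real.one_le_exp (by norm_num)
      have h4 : s ≤ 24 := by linarith [hs.2, hb.2]
      nlinarith [hp.2]
    · have hs' := Ioo_subset_Icc_self hs
      have hw1 := hw s hs'
      have hwM := hwM s hs'
      have hw0 : 0 < z s 2 := by linarith
      have hQ0 := hQ0 s hs'
      have hQ1 := hQ1 s hs'
      have hV2 : z s 3 ^ 2 ≤ 4 ^ 2 := pow_le_pow_left₀ (hV0 s hs') (hV4 s hs') 2
      have hR0 := planeRadius_pos (z s 0) hw0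
      have hR := hw1.trans (le_planeRadius (z s 0) (z s 2))
      have a : 0 < 1 / z s 2 := by positivity
      have b : 0 < 1 / planeRadius (z s 0) (z s 2) := by positivity
      have c : z s 0 ^ 5 / planeRadius (z s 0) (z s 2) ^ 3 ≤ 1 := by
        rw [div_le_one (by positivity)]
        exact (pow_le_one₀ hQ0 hQ1).trans (one_le_pow₀ hR)
      have hes := (startEnergy_mem hp).1
      have d : -8 ≤ z s 0 * (startEnergy p + 1 / z s 2 + 1 / planeRadius (z s 0) (z s 2)
          - z s 3 ^ 2 / 4) - z s 0 ^ 5 / planeRadius (z s 0) (z s 2) ^ 3 := by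
        nlinarith
      rw [binaryForce]
      nlinarith
  have hproj1 : ∀ s ∈ Icc 0 b, boxProj boxLo boxHi (z s) 1 = z s 1 := fun s hs =>
    boxProj_apply_of_mem (hyM s hs) (hy0 s hs)
  refine ⟨hb.1, by rw [hz0]; rfl, by rw [hz0]; rfl, by rw [hz0]; rfl, by rw [hz0]; rfl, fun s hs => ?_,
    fun s hs => ?_, fun s hs => ?_, fun s hs => ?_, hQ, hV, hw⟩
  · refine (hz s (hsub s hs) 0).congr_deriv ?_
    show boxProj boxLo boxHi (z s) 1 * boxProj boxLo boxHi (z s) 2 = _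
    rw [hproj1 s hs, hproj 2 (by decide) s hs]
  · exact (hz s (hsub s hs) 1).congr_deriv (hforce s hs)
  · refine (hz s (hsub s hs) 2).congr_deriv ?_
    show boxProj boxLo boxHi (z s) 0 ^ 2 * boxProj boxLo boxHi (z s) 2
      * boxProj boxLo boxHi (z s) 3 = _
    rw [hproj 0 (by decide) s hs, hproj 2 (by decide) s hs, hproj 3 (by decide) s hs]
  · refine (hz s (hsub s hs) 3).congr_deriv ?_
    show transverseForce (boxProj boxLo boxHi (z s) 0) (boxProj boxLo boxHi (z s) 2) = _
    rw [hproj 0 (by decide) s hs, hproj 2 (by decide) s hs]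

/-- The sign condition on y is automatic: up to a first zero of y the curve would be a shooting arc,
on which y ≤ -1/23. -/
theorem isShootingArc_of_pos {p b : ℝ} (hp : p ∈ shootingSpeeds) (hb : b ∈ Ioo (0 : ℝ) 24)
    {z : ℝ → Fin 5 → ℝ} (hz0 : z 0 = shootingStart p)
    (hz : ∀ s ∈ Ioo (-24 : ℝ) 24, ∀ i,
      HasDerivAt (fun s => z s i) (shootingField (boxProj boxLo boxHi (z s)) i) s)
    (hQ : ∀ s ∈ Ico 0 b, 0 < z s 0) (hV : ∀ s ∈ Ico 0 b, 0 < z s 3) :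
    IsShootingArc p b (fun s => z s 0) (fun s => z s 1) (fun s => z s 2) (fun s => z s 3) := by
  refine isShootingArc_of_neg hp hb hz0 hz hQ hV fun s hs => ?_
  by_contra! hcon
  have hc : ContinuousOn (fun s => -z s 1) (Icc 0 b) := fun s hs =>
    (hz s ⟨by linarith [hs.1], hs.2.trans_lt hb.2⟩ 1).continuousAt.continuousWithinAt.neg
  have h0 : z 0 1 = -p := by rw [hz0]; rfl
  have hp0 := hp.1
  obtain ⟨c, hc, hzc, hpos⟩ := exists_first_zero (b := s) (hc.mono (Icc_subset_Icc_right hs.2.le))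
    (by rw [h0]; linarith) ⟨hs.1, le_rfl⟩ (neg_nonpos.2 hcon)
  have hcb : c < b := hc.2.trans_lt hs.2
  have harc := isShootingArc_of_neg hp ⟨hc.1, hcb.trans hb.2⟩ hz0 hz
    (fun t ht => hQ t ⟨ht.1, ht.2.trans hcb⟩) (fun t ht => hV t ⟨ht.1, ht.2.trans hcb⟩)
    (fun t ht => neg_pos.1 (hpos t ht))
  have := harc.y_le_neg hp.1 c harc.end_mem
  linarith

/-! ### Connectedness in the shooting parameter -/

/-- For a continuous family of functions, positivity on an initial interval and negativity of
another function at its end are open conditions on the parameter. -/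
theorem eventually_neg_pos {g h : ℝ → ℝ → ℝ} {S : Set ℝ} {T s p : ℝ}
    (hg : ContinuousOn (fun x : ℝ × ℝ => g x.1 x.2) (S ×ˢ Icc (-T) T))
    (hh : ContinuousOn (fun x : ℝ × ℝ => h x.1 x.2) (S ×ˢ Icc (-T) T))
    (hp : p ∈ S) (hs : s ∈ Icc 0 T) (hgs : g p s < 0) (hpos : ∀ t ∈ Icc 0 s, 0 < h p t) :
    ∀ᶠ q in 𝓝[S] p, g q s < 0 ∧ ∀ t ∈ Icc 0 s, 0 < h q t := by
  have hT : ∀ t ∈ Icc 0 s, t ∈ Icc (-T) T := fun t ht =>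
    ⟨by linarith [hs.1, hs.2, ht.1], ht.2.trans hs.2⟩
  have hgc : ContinuousOn (fun q => g q s) S :=
    hg.comp (f := fun q => (q, s)) (by fun_prop) fun q hq => ⟨hq, hT s ⟨hs.1, le_rfl⟩⟩
  refine ((hgc p hp).eventually_lt_const hgs).and ?_
  -- Compactness of [0, s] makes the neighbourhood of p uniform in t.
  have := isCompact_Icc.eventually_forall_of_forall_eventually
    (K := Icc 0 s) (x₀ := p) (P := fun q t => q ∈ S → t ∈ Icc 0 s → 0 < h q t) fun t ht => by
      have h1 : ContinuousWithinAt (fun x : ℝ × ℝ => h x.1 x.2) (S ×ˢ Icc 0 s) (p, t) :=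
        (hh (p, t) ⟨hp, hT t ht⟩).mono (prod_mono le_rfl hT)
      filter_upwards [eventually_nhdsWithin_iff.1 (h1.eventually_const_lt (hpos t ht))]
        with x hx hxS hxt using hx ⟨hxS, hxt⟩
  filter_upwards [mem_nhdsWithin_of_mem_nhds this, self_mem_nhdsWithin] with q hq hqS t ht
  exact hq t ht hqS ht

/-- For some shooting speed, the first collision and the first zero of `V` happen at the same
time. -/
theorem exists_shootingArc : ∃ (p b : ℝ) (Q y w V : ℝ → ℝ), 0 < p ∧ IsShootingArc p b Q y w V ∧
    Q b = 0 ∧ V b = 0 := by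
  obtain ⟨α, hc, hα⟩ := exists_shooting_family
  have hci : ∀ i, ContinuousOn (fun x : ℝ × ℝ => α x.1 x.2 i) (shootingSpeeds ×ˢ Icc (-24) 24) :=
    fun i => (continuous_apply i).comp_continuousOn hc
  have harc : ∀ p ∈ shootingSpeeds, ∀ b ∈ Ioo (0 : ℝ) 24, (∀ s ∈ Ico 0 b, 0 < α p s 0) →
      (∀ s ∈ Ico 0 b, 0 < α p s 3) → IsShootingArc p b (fun s => α p s 0) (fun s => α p s 1)
        (fun s => α p s 2) (fun s => α p s 3) := fun p hp b hb hQ hV =>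
    isShootingArc_of_pos hp hb (hα p hp).1 (hα p hp).2 hQ hV
  -- the end of the longest arc
  have hend : ∀ p ∈ shootingSpeeds, ∃ b ∈ Ioo (0 : ℝ) 24, IsShootingArc p b (fun s => α p s 0)
      (fun s => α p s 1) (fun s => α p s 2) (fun s => α p s 3) ∧ (α p b 0 = 0 ∨ α p b 3 = 0) := by
    intro p hp
    have hp1 := hp.1
    have hcont : ContinuousOn (fun s => min (α p s 0) (α p s 3)) (Icc 0 (47 / 2)) := by
      have hi : ∀ i, ContinuousOn (fun s => α p s i) (Icc 0 (47 / 2)) := fun i s hs =>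
        ((hα p hp).2 s ⟨by linarith [hs.1], by linarith [hs.2]⟩ i).continuousAt.continuousWithinAt
      exact (hi 0).inf (hi 3)
    have h0 : 0 < min (α p 0 0) (α p 0 3) := by
      rw [(hα p hp).1]
      exact lt_min zero_lt_one (mul_pos two_pos (by linarith))
    -- The time 47/2 lies between the maximal length 23 of an arc and the end 24 of the flow.
    have hex : ∃ s ∈ Icc (0 : ℝ) (47 / 2), min (α p s 0) (α p s 3) ≤ 0 := by
      by_contra! hcon
      have := (harc p hp (47 / 2) ⟨by norm_num, by norm_num⟩
        (fun s hs => (lt_min_iff.1 (hcon s (Ico_subset_Icc_self hs))).1)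
        (fun s hs => (lt_min_iff.1 (hcon s (Ico_subset_Icc_self hs))).2)).b_le hp1
      norm_num at this
    obtain ⟨s, hs, hsle⟩ := hex
    obtain ⟨c, hcm, hc0, hpos⟩ := exists_first_zero hcont h0 hs hsle
    have hc24 : c ∈ Ioo (0 : ℝ) 24 := ⟨hcm.1, by linarith [hcm.2]⟩
    refine ⟨c, hc24, harc p hp c hc24 (fun s hs => (lt_min_iff.1 (hpos s hs)).1)
      (fun s hs => (lt_min_iff.1 (hpos s hs)).2), ?_⟩
    rcases min_choice (α p c 0) (α p c 3) with h | h <;> rw [h] at hc0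
    exacts [Or.inl hc0, Or.inr hc0]
  by_contra! hno
  -- In `A` the collision comes first, in `B` the zero of V. Demanding that the truncated flow goes
  -- on to a strictly negative value makes both conditions open.
  let A : Set ℝ := {p | ∃ s ∈ Icc (0 : ℝ) 24, α p s 0 < 0 ∧ ∀ t ∈ Icc 0 s, 0 < α p t 3}
  let B : Set ℝ := {p | ∃ s ∈ Icc (0 : ℝ) 24, α p s 3 < 0 ∧ ∀ t ∈ Icc 0 s, 0 < α p t 0}
  have hAo : ∀ p ∈ shootingSpeeds, p ∈ A → ∀ᶠ q in 𝓝[shootingSpeeds] p, q ∈ A := by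
    rintro p hp ⟨s, hs, h1, h2⟩
    filter_upwards [eventually_neg_pos (g := fun p s => α p s 0) (h := fun p s => α p s 3) (hci 0)
      (hci 3) hp hs h1 h2] with q hq
    exact ⟨s, hs, hq⟩
  have hBo : ∀ p ∈ shootingSpeeds, p ∈ B → ∀ᶠ q in 𝓝[shootingSpeeds] p, q ∈ B := by
    rintro p hp ⟨s, hs, h1, h2⟩
    filter_upwards [eventually_neg_pos (g := fun p s => α p s 3) (h := fun p s => α p s 0) (hci 3)
      (hci 0) hp hs h1 h2] with q hq
    exact ⟨s, hs, hq⟩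
  have hdisj : ∀ p, p ∈ A → p ∈ B → False := by
    rintro p ⟨s, hs, h1, h2⟩ ⟨s', hs', h1', h2'⟩
    rcases le_total s s' with h | h
    · exact absurd (h2' s ⟨hs.1, h⟩) (not_lt.2 h1.le)
    · exact absurd (h2 s' ⟨hs'.1, h⟩) (not_lt.2 h1'.le)
  -- a function with a negative derivative at a zero is negative soon after it, while another
  -- function stays positive
  have hcross : ∀ p ∈ shootingSpeeds, ∀ b ∈ Ioo (0 : ℝ) 24, ∀ i j d, α p b i = 0 → d < 0 →
      HasDerivAt (fun s => α p s i) d b → (∀ s ∈ Ico 0 b, 0 < α p s j) → 0 < α p b j →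
      ∃ s ∈ Icc (0 : ℝ) 24, α p s i < 0 ∧ ∀ t ∈ Icc 0 s, 0 < α p t j := by
    intro p hp b hb i j d hz hd hder hj hjb
    have h1 : ∀ᶠ s in 𝓝[>] b, α p s i < 0 := by
      have := (hasDerivAt_iff_tendsto_slope.1 hder).mono_left
        (nhdsWithin_mono b fun s (hs : b < s) => hs.ne')
      filter_upwards [this.eventually_lt_const hd, self_mem_nhdsWithin] with s hs hbs
      rw [slope_def_field, hz, sub_zero] at hs
      have : 0 < s - b := sub_pos.2 hbs
      by_contra! hcon
      exact absurd hs (not_lt.2 (div_nonneg hcon this.le))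
    have hcj : ContinuousAt (fun s => α p s j) b :=
      ((hα p hp).2 b ⟨by linarith [hb.1], hb.2⟩ j).continuousAt
    obtain ⟨ε, hε, hball⟩ := Metric.eventually_nhds_iff.1 (hcj.eventually_const_lt hjb)
    have h2 : ∀ᶠ s in 𝓝[>] b, s < min (b + ε) 24 :=
      nhdsWithin_le_nhds (eventually_lt_nhds (lt_min (by linarith) hb.2))
    obtain ⟨s, hs1, hs2, hs3⟩ := (h1.and (h2.and self_mem_nhdsWithin)).exists
    have hs3 : b < s := hs3
    refine ⟨s, ⟨(hb.1.trans hs3).le, (hs2.trans_le (min_le_right _ _)).le⟩, hs1, fun t ht => ?_⟩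
    rcases lt_or_ge t b with h | h
    · exact hj t ⟨ht.1, h⟩
    · refine hball ?_
      rw [Real.dist_eq, abs_of_nonneg (by linarith)]
      linarith [ht.2, hs2.trans_le (min_le_left _ _)]
  have hA : ∀ p ∈ shootingSpeeds, ∀ b ∈ Ioo (0 : ℝ) 24, IsShootingArc p b (fun s => α p s 0)
      (fun s => α p s 1) (fun s => α p s 2) (fun s => α p s 3) → α p b 0 = 0 → 0 < α p b 3 →
      p ∈ A := by
    intro p hp b hb h hQ hV
    refine hcross p hp b hb 0 3 _ hQ ?_ (h.hQ b h.end_mem) h.V_pos hV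
    exact mul_neg_of_neg_of_pos (by linarith [h.y_le_neg hp.1 b h.end_mem]) (h.w_pos h.end_mem)
  have hB : ∀ p ∈ shootingSpeeds, ∀ b ∈ Ioo (0 : ℝ) 24, IsShootingArc p b (fun s => α p s 0)
      (fun s => α p s 1) (fun s => α p s 2) (fun s => α p s 3) → α p b 3 = 0 → 0 < α p b 0 →
      p ∈ B := by
    intro p hp b hb h hV hQ
    refine hcross p hp b hb 3 0 _ hV ?_ (h.hV b h.end_mem) h.Q_pos hQ
    have hw := h.w_pos h.end_mem
    have := planeRadius_pos (α p b 0) hw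
    have h1 : 0 < 2 * α p b 0 ^ 2 * (1 / α p b 2 + α p b 2 ^ 2 / planeRadius (α p b 0) (α p b 2) ^ 3) := by
      positivity
    simp only [transverseForce]
    linarith
  have hcover : ∀ p ∈ shootingSpeeds, p ∈ A ∨ p ∈ B := by
    intro p hp
    obtain ⟨b, hb, h, hz⟩ := hend p hp
    have hp0 : 0 < p := by linarith [hp.1]
    have h0 := h.Q_nonneg b h.end_mem
    have h3 := h.V_nonneg b h.end_mem
    rcases hz with hz | hz
    · exact Or.inl (hA p hp b hb h hz (lt_of_le_of_ne h3 (hno p b _ _ _ _ hp0 h hz).symm))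
    · refine Or.inr (hB p hp b hb h hz (lt_of_le_of_ne h0 fun h' => ?_))
      exact hno p b _ _ _ _ hp0 h h'.symm hz
  have hlo : (1 / 13 : ℝ) ∈ shootingSpeeds := ⟨le_rfl, by norm_num⟩
  have hhi : (2 : ℝ) ∈ shootingSpeeds := ⟨by norm_num, le_rfl⟩
  have hloB : (1 / 13 : ℝ) ∈ B := by
    obtain ⟨b, hb, h, hz⟩ := hend _ hlo
    exact hB _ hlo b hb h (hz.resolve_left h.Q_end_pos.ne') h.Q_end_pos
  have hhiA : (2 : ℝ) ∈ A := by
    obtain ⟨b, hb, h, hz⟩ := hend _ hhi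
    exact hA _ hhi b hb h (hz.resolve_right h.V_end_pos.ne') h.V_end_pos
  have hconn : IsPreconnected shootingSpeeds := isPreconnected_Icc
  have hsub : ∀ C : Set ℝ, (∀ p ∈ shootingSpeeds, p ∈ C → ∀ᶠ q in 𝓝[shootingSpeeds] p, q ∈ C) →
      ∃ u, IsOpen u ∧ shootingSpeeds ∩ u = shootingSpeeds ∩ C := by
    intro C hC
    have : IsOpen (Subtype.val ⁻¹' C : Set shootingSpeeds) := by
      rw [isOpen_iff_mem_nhds]
      rintro ⟨p, hp⟩ hpC
      rw [nhds_subtype_eq_comap_nhdsWithin]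
      exact preimage_mem_comap (hC p hp hpC)
    obtain ⟨u, hu, huC⟩ := isOpen_induced_iff.1 this
    exact ⟨u, hu, Subtype.preimage_coe_eq_preimage_coe_iff.1 huC⟩
  obtain ⟨u, hu, huA⟩ := hsub A hAo
  obtain ⟨v, hv, hvB⟩ := hsub B hBo
  obtain ⟨p, hp, hpu, hpv⟩ := hconn u v hu hv
    (fun p hp => (hcover p hp).imp (fun h => (huA.ge ⟨hp, h⟩).2) fun h => (hvB.ge ⟨hp, h⟩).2)
    ⟨2, huA.ge ⟨hhi, hhiA⟩⟩ ⟨1 / 13, hvB.ge ⟨hlo, hloB⟩⟩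
  exact hdisj p (huA.le ⟨hp, hpu⟩).2 (hvB.le ⟨hp, hpv⟩).2

/-! ### Symmetries of the regularized system and the closed orbit -/

/-- The Hamiltonian vector field of the normalized regularized Hamiltonian of energy `e`, in the
coordinates `Q₁`, `Q₂`, `Y₁`, `Y₂`. -/
noncomputable def normalizedField (e : ℝ) (z : Fin 4 → ℝ) : Fin 4 → ℝ :=
  ![z 2 * z 1 ^ 2, z 3 * z 0 ^ 2,
    z 0 * (1 - z 3 ^ 2 + z 1 ^ 2 / √(z 0 ^ 4 + z 1 ^ 4)
      - z 0 ^ 4 * z 1 ^ 2 / √(z 0 ^ 4 + z 1 ^ 4) ^ 3 + e * z 1 ^ 2),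
    z 1 * (1 - z 2 ^ 2 + z 0 ^ 2 / √(z 1 ^ 4 + z 0 ^ 4)
      - z 1 ^ 4 * z 0 ^ 2 / √(z 1 ^ 4 + z 0 ^ 4) ^ 3 + e * z 0 ^ 2)]

/-- The normalized regularized Hamiltonian of energy `e`. -/
noncomputable def normalizedHamiltonian (e : ℝ) (z : Fin 4 → ℝ) : ℝ :=
  z 2 ^ 2 * z 1 ^ 2 + z 3 ^ 2 * z 0 ^ 2 - z 0 ^ 2 - z 1 ^ 2
    - z 0 ^ 2 * z 1 ^ 2 / √(z 0 ^ 4 + z 1 ^ 4) - e * z 0 ^ 2 * z 1 ^ 2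

/-- The rotation of order four of the phase space, a symmetry of the regularized problem. -/
noncomputable def phaseRotation : (Fin 4 → ℝ) ≃L[ℝ] (Fin 4 → ℝ) :=
  LinearEquiv.toContinuousLinearEquiv
    { toFun := fun z => ![-z 1, z 0, -z 3, z 2]
      invFun := fun z => ![z 1, -z 0, z 3, -z 2]
      map_add' := fun z z' => by ext i; fin_cases i <;> simp <;> ring
      map_smul' := fun c z => by ext i; fin_cases i <;> simp
      left_inv := fun z => by ext i; fin_cases i <;> simp
      right_inv := fun z => by ext i; fin_cases i <;> simp }

theorem phaseRotation_apply (z : Fin 4 → ℝ) : phaseRotation z = ![-z 1, z 0, -z 3, z 2] := rfl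

theorem normalizedField_phaseRotation (e : ℝ) (z : Fin 4 → ℝ) :
    normalizedField e (phaseRotation z) = phaseRotation (normalizedField e z) := by
  ext i
  have h1 : (-z 1) ^ 4 = z 1 ^ 4 := by ring
  fin_cases i <;> simp [phaseRotation_apply, normalizedField, h1]

theorem normalizedHamiltonian_phaseRotation (e : ℝ) (z : Fin 4 → ℝ) :
    normalizedHamiltonian e (phaseRotation z) = normalizedHamiltonian e z := by
  have h1 : (-z 1) ^ 4 + z 0 ^ 4 = z 0 ^ 4 + z 1 ^ 4 := by ring
  simp only [phaseRotation_apply, normalizedHamiltonian]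
  simp [h1]
  ring

/-- The reflection of the phase space which reverses the time of the regularized problem. -/
def phaseReflection (z : Fin 4 → ℝ) : Fin 4 → ℝ :=
  ![-z 0, z 1, z 2, -z 3]

theorem normalizedHamiltonian_phaseReflection (e : ℝ) (z : Fin 4 → ℝ) :
    normalizedHamiltonian e (phaseReflection z) = normalizedHamiltonian e z := by
  have h1 : (-z 0) ^ 4 = z 0 ^ 4 := by ring
  simp [phaseReflection, normalizedHamiltonian, h1]

theorem normalizedField_phaseReflection (e : ℝ) (z : Fin 4 → ℝ) :
    normalizedField e (phaseReflection z) = -phaseReflection (normalizedField e z) := by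
  have h1 : (-z 0) ^ 4 = z 0 ^ 4 := by ring
  ext i
  fin_cases i <;> simp [phaseReflection, normalizedField, h1]

/-- This dihedral relation carries the reflection identity from one fundamental interval to all
times. -/
theorem phaseRotation_phaseReflection_phaseRotation (z : Fin 4 → ℝ) :
    phaseRotation (phaseReflection (phaseRotation z)) = phaseReflection z := by
  ext i
  fin_cases i <;> simp [phaseRotation_apply, phaseReflection]

/-- A solution of the normalized regularized problem, with the symmetries and the collisions of the
periodic orbit whose first collision is at the time `b`. -/
structure IsNormalizedOrbit (e p b : ℝ) (z : ℝ → Fin 4 → ℝ) : Prop where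
  p_pos : 0 < p
  b_pos : 0 < b
  e_neg : e < 0
  start : z 0 = ![1, 1, -p, p]
  deriv : ∀ s, HasDerivAt z (normalizedField e (z s)) s
  level : ∀ s, normalizedHamiltonian e (z s) = 0
  rotate : ∀ s, z (s + 2 * b) = phaseRotation (z s)
  reflect : ∀ s, z (2 * b - s) = phaseReflection (z s)
  zero₁ : ∀ s, z s 0 = 0 ↔ ∃ k : ℤ, s = b + 4 * b * k
  zero₂ : ∀ s, z s 1 = 0 ↔ ∃ k : ℤ, s = 3 * b + 4 * b * k

namespace IsShootingArc

variable {p b : ℝ} {Q y w V : ℝ → ℝ}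

/-- A shooting arc in the coordinates of the regularized problem. -/
noncomputable def phaseCurve (Q y w V : ℝ → ℝ) (s : ℝ) : Fin 4 → ℝ :=
  ![Q s, √(w s), y s, V s * √(w s) / 2]

theorem sqrt_w_sq (h : IsShootingArc p b Q y w V) {s : ℝ} (hs : s ∈ Icc 0 b) : √(w s) ^ 2 = w s :=
  Real.sq_sqrt (h.w_pos hs).le

theorem sqrt_eq_planeRadius (h : IsShootingArc p b Q y w V) {s : ℝ} (hs : s ∈ Icc 0 b) :
    √(Q s ^ 4 + √(w s) ^ 4) = planeRadius (Q s) (w s) := by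
  rw [planeRadius, show √(w s) ^ 4 = (√(w s) ^ 2) ^ 2 by ring, h.sqrt_w_sq hs]

/-- Here Y₂ = V√w/2. Only its equation needs the energy relation, which eliminates y²; the other
three are direct substitutions. -/
theorem hasDerivAt_phaseCurve (h : IsShootingArc p b Q y w V) {s : ℝ} (hs : s ∈ Icc 0 b) :
    HasDerivAt (phaseCurve Q y w V) (normalizedField (startEnergy p) (phaseCurve Q y w V s)) s := by
  have hw0 := h.w_pos hs
  have hr : 0 < √(w s) := Real.sqrt_pos.2 hw0
  have hr2 := h.sqrt_w_sq hs
  have hR := h.sqrt_eq_planeRadius hs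
  have hR0 := planeRadius_pos (Q s) hw0
  have hR2 := planeRadius_sq (Q s) (w s)
  have hsq := (h.hw s hs).sqrt hw0.ne'
  have he := h.energy s hs
  rw [hasDerivAt_pi]
  intro i
  fin_cases i
  · refine (h.hQ s hs).congr_deriv ?_
    simp [normalizedField, phaseCurve, hr2]
  · refine hsq.congr_deriv ?_
    simp only [normalizedField, phaseCurve]
    simp
    field_simp
    rw [hr2]
    ring
  · refine (h.hy s hs).congr_deriv ?_
    simp only [normalizedField, phaseCurve, binaryForce]
    simp
    rw [hR, show (V s * √(w s) / 2) ^ 2 = V s ^ 2 * √(w s) ^ 2 / 4 by ring, hr2]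
    field_simp
    ring
  · refine (((h.hV s hs).mul hsq).div_const 2).congr_deriv ?_
    simp only [normalizedField, phaseCurve, transverseForce]
    simp
    rw [add_comm (√(w s) ^ 4), hR, show √(w s) ^ 4 = (√(w s) ^ 2) ^ 2 by ring, hr2, he]
    generalize planeRadius (Q s) (w s) = R at *
    generalize startEnergy p = e at *
    generalize √(w s) = r at *
    rw [← hr2]
    field_simp
    ring

theorem normalizedHamiltonian_phaseCurve (h : IsShootingArc p b Q y w V) {s : ℝ}
    (hs : s ∈ Icc 0 b) : normalizedHamiltonian (startEnergy p) (phaseCurve Q y w V s) = 0 := by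
  have hw0 := h.w_pos hs
  have hR0 := planeRadius_pos (Q s) hw0
  simp only [normalizedHamiltonian, phaseCurve]
  simp
  rw [h.sqrt_eq_planeRadius hs, show (V s * √(w s) / 2) ^ 2 = V s ^ 2 * √(w s) ^ 2 / 4 by ring,
    h.sqrt_w_sq hs, h.energy s hs]
  field_simp
  ring

/-- The arc which follows a phase curve up to the time `b`, and then its reflection. -/
noncomputable def reflectedCurve (b : ℝ) (Q y w V : ℝ → ℝ) (s : ℝ) : Fin 4 → ℝ :=
  if s ≤ b then phaseCurve Q y w V s else phaseReflection (phaseCurve Q y w V (2 * b - s))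

theorem reflectedCurve_of_le {s : ℝ} (hs : s ≤ b) :
    reflectedCurve b Q y w V s = phaseCurve Q y w V s :=
  if_pos hs

theorem reflectedCurve_of_ge (hQ : Q b = 0) (hV : V b = 0) {s : ℝ} (hs : b ≤ s) :
    reflectedCurve b Q y w V s = phaseReflection (phaseCurve Q y w V (2 * b - s)) := by
  rcases hs.lt_or_eq with h | rfl
  · exact if_neg (not_le.2 h)
  · rw [reflectedCurve_of_le le_rfl, show 2 * b - b = b by ring]
    simp [phaseReflection, phaseCurve, hQ, hV]

theorem reflectedCurve_reflect (hQ : Q b = 0) (hV : V b = 0) (s : ℝ) :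
    reflectedCurve b Q y w V (2 * b - s) = phaseReflection (reflectedCurve b Q y w V s) := by
  rcases le_total s b with h | h
  · rw [reflectedCurve_of_ge hQ hV (by linarith), reflectedCurve_of_le h, sub_sub_cancel]
  · rw [reflectedCurve_of_ge hQ hV h, reflectedCurve_of_le (by linarith)]
    ext i
    fin_cases i <;> simp [phaseReflection]

theorem hasDerivWithinAt_reflectedCurve (h : IsShootingArc p b Q y w V) (hQ : Q b = 0)
    (hV : V b = 0) {s : ℝ} (hs : s ∈ Icc 0 (2 * b)) :
    HasDerivWithinAt (reflectedCurve b Q y w V)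
      (normalizedField (startEnergy p) (reflectedCurve b Q y w V s)) (Icc 0 (2 * b)) s := by
  have hb := h.b_pos
  rw [← Icc_union_Icc_eq_Icc hb.le (by linarith : b ≤ 2 * b)]
  refine HasDerivWithinAt.union ?_ ?_
  · by_cases hsb : s ≤ b
    · rw [reflectedCurve_of_le hsb]
      exact (h.hasDerivAt_phaseCurve ⟨hs.1, hsb⟩).hasDerivWithinAt.congr
        (fun t ht => reflectedCurve_of_le ht.2) (reflectedCurve_of_le hsb)
    -- Off the closed half interval the derivative within it is vacuous.
    · refine HasFDerivWithinAt.of_notMem_closure ?_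
      rw [closure_Icc]
      exact fun hs' => hsb hs'.2
  · by_cases hsb : b ≤ s
    · rw [reflectedCurve_of_ge hQ hV hsb, normalizedField_phaseReflection]
      have h1 := (h.hasDerivAt_phaseCurve (s := 2 * b - s)
        ⟨by linarith [hs.2], by linarith⟩).scomp s ((hasDerivAt_id s).const_sub (2 * b))
      have h2 : HasDerivAt (fun s => phaseReflection (phaseCurve Q y w V (2 * b - s)))
          (-phaseReflection (normalizedField (startEnergy p) (phaseCurve Q y w V (2 * b - s)))) s := by
        rw [hasDerivAt_pi] at h1 ⊢
        intro i
        fin_cases i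
        · exact (h1 0).neg.congr_deriv (by simp [phaseReflection])
        · exact (h1 1).congr_deriv (by simp [phaseReflection])
        · exact (h1 2).congr_deriv (by simp [phaseReflection])
        · exact (h1 3).neg.congr_deriv (by simp [phaseReflection])
      exact h2.hasDerivWithinAt.congr
        (fun t ht => reflectedCurve_of_ge hQ hV ht.1) (reflectedCurve_of_ge hQ hV hsb)
    · refine HasFDerivWithinAt.of_notMem_closure ?_
      rw [closure_Icc]
      exact fun hs' => hsb hs'.1

end IsShootingArc

-- The end of the arc, with Q₁ = Y₂ = 0, is fixed by the reflection, so arc and mirror image join to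
-- a solution on [0, 2b]; the rotation extends it. On that interval Q₁ vanishes only at b and Q₂
-- never, and the rotation exchanges the two up to sign.
open IsShootingArc in
theorem exists_normalizedOrbit : ∃ e p b z, IsNormalizedOrbit e p b z := by
  obtain ⟨p, b, Q, y, w, V, hp, h, hQ, hV⟩ := exists_shootingArc
  have hb := h.b_pos
  have hL : 0 < 2 * b := by linarith
  set f := reflectedCurve b Q y w V with hf
  have h0 : f 0 = ![1, 1, -p, p] := by
    rw [hf, reflectedCurve_of_le hb.le]
    simp [phaseCurve, h.Q_zero, h.y_zero, h.w_zero, h.V_zero]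
  -- Reflection and rotation send the starting point (1, 1, -p, p) to the same point (-1, 1, -p,
  -- -p).
  have hfL : f (2 * b) = phaseRotation (f 0) := by
    have := reflectedCurve_reflect (y := y) (w := w) hQ hV 0
    rw [sub_zero, ← hf, h0] at this
    rw [this, h0, phaseRotation_apply]
    simp [phaseReflection]
  set z := equivariantExtension phaseRotation (2 * b) f with hz
  have hzf : ∀ s ∈ Icc 0 (2 * b), z s = f s := fun s hs => by
    rw [hz, equivariantExtension_of_mem_Icc hL hfL 0 (by simpa using hs)]
    simp only [Int.cast_zero, zero_mul, sub_zero, zpow_zero]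
    rfl
  have hrot : ∀ s, z (s + 2 * b) = phaseRotation (z s) := equivariantExtension_add hL
  have hrefl : ∀ s, z (2 * b - s) = phaseReflection (z s) := by
    refine forall_of_forall_mem_Icc hL (fun s => ?_) fun s hs => ?_
    · have h1 := hrot (2 * b - (s + 2 * b))
      rw [show 2 * b - (s + 2 * b) + 2 * b = 2 * b - s by ring] at h1
      rw [h1, hrot, ← phaseRotation_phaseReflection_phaseRotation (z s)]
      exact phaseRotation.injective.eq_iff.symm
    · rw [hzf s hs, hzf _ ⟨by linarith [hs.2], by linarith [hs.1]⟩]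
      exact reflectedCurve_reflect hQ hV s
  have hzero : ∀ s, (z s 0 = 0 ↔ ∃ k : ℤ, s = b + 4 * b * k) ∧
      (z s 1 = 0 ↔ ∃ k : ℤ, s = 3 * b + 4 * b * k) := by
    refine forall_of_forall_mem_Icc hL (fun s => ?_) fun s hs => ?_
    · have e1 : z (s + 2 * b) 0 = 0 ↔ z s 1 = 0 := by
        rw [hrot, phaseRotation_apply]
        simp
      have e2 : z (s + 2 * b) 1 = 0 ↔ z s 0 = 0 := by
        rw [hrot, phaseRotation_apply]
        simp
      have e3 : (∃ k : ℤ, s + 2 * b = b + 4 * b * k) ↔ ∃ k : ℤ, s = 3 * b + 4 * b * k :=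
        ⟨fun ⟨k, hk⟩ => ⟨k - 1, by push_cast; linarith⟩, fun ⟨k, hk⟩ => ⟨k + 1, by push_cast; linarith⟩⟩
      have e4 : (∃ k : ℤ, s + 2 * b = 3 * b + 4 * b * k) ↔ ∃ k : ℤ, s = b + 4 * b * k :=
        ⟨fun ⟨k, hk⟩ => ⟨k, by linarith⟩, fun ⟨k, hk⟩ => ⟨k, by linarith⟩⟩
      rw [e1, e2, e3, e4, and_comm]
    · have e1 : (∃ k : ℤ, s = b + 4 * b * k) ↔ s = b := by
        refine ⟨fun ⟨k, hk⟩ => ?_, fun hk => ⟨0, by simpa using hk⟩⟩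
        have h1 : (-1 : ℝ) < k := by
          by_contra! hcon
          nlinarith [hs.1]
        have h2 : (k : ℝ) < 1 := by
          by_contra! hcon
          nlinarith [hs.2]
        have : k = 0 := by
          have h1 : -1 < k := by exact_mod_cast h1
          have h2 : k < 1 := by exact_mod_cast h2
          omega
        simpa [this] using hk
      have e2 : ¬ ∃ k : ℤ, s = 3 * b + 4 * b * k := by
        rintro ⟨k, hk⟩
        have h1 : (-1 : ℝ) < k := by
          by_contra! hcon
          nlinarith [hs.1]
        have h2 : (k : ℝ) < 0 := by
          by_contra! hcon
          nlinarith [hs.2]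
        have h1 : -1 < k := by exact_mod_cast h1
        have h2 : k < 0 := by exact_mod_cast h2
        omega
      have hw : ∀ t ∈ Icc 0 b, √(w t) ≠ 0 := fun t ht => (Real.sqrt_pos.2 (h.w_pos ht)).ne'
      rw [e1, iff_false_right e2, hzf s hs]
      rcases le_total s b with hsb | hsb
      · rw [hf, reflectedCurve_of_le hsb]
        refine ⟨⟨fun h' => ?_, fun h' => by rw [h']; exact hQ⟩, hw s ⟨hs.1, hsb⟩⟩
        by_contra hne
        exact (h.Q_pos s ⟨hs.1, lt_of_le_of_ne hsb hne⟩).ne' h'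
      · rw [hf, reflectedCurve_of_ge hQ hV hsb]
        have hm : 2 * b - s ∈ Icc 0 b := ⟨by linarith [hs.2], by linarith⟩
        refine ⟨⟨fun h' => ?_, fun h' => ?_⟩, hw _ hm⟩
        · by_contra hne
          exact (h.Q_pos (2 * b - s) ⟨hm.1, by linarith [lt_of_le_of_ne hsb (Ne.symm hne)]⟩).ne'
            (neg_eq_zero.1 h')
        · rw [h', show 2 * b - b = b by ring]
          exact neg_eq_zero.2 hQ
  refine ⟨startEnergy p, p, b, z, hp, hb, h.startEnergy_neg hQ hV, ?_, ?_, ?_, hrot, hrefl,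
    fun s => (hzero s).1, fun s => (hzero s).2⟩
  · rw [hzf 0 ⟨le_rfl, hL.le⟩, h0]
  · exact hasDerivAt_equivariantExtension hL hfL (normalizedField_phaseRotation _)
      fun s hs => h.hasDerivWithinAt_reflectedCurve hQ hV hs
  · refine forall_of_forall_mem_Icc hL (fun s => ?_) fun s hs => ?_
    · rw [hrot, normalizedHamiltonian_phaseRotation]
    · rw [hzf s hs]
      rcases le_total s b with hsb | hsb
      · rw [hf, reflectedCurve_of_le hsb, h.normalizedHamiltonian_phaseCurve ⟨hs.1, hsb⟩]
      · rw [hf, reflectedCurve_of_ge hQ hV hsb, normalizedHamiltonian_phaseReflection,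
          h.normalizedHamiltonian_phaseCurve ⟨by linarith [hs.2], by linarith⟩]

/-! ### Forces and energies of symmetric configurations -/

/-- The symmetric configuration with body 1 at `(a, b)`. -/
noncomputable def symmetricConfiguration (a b : ℝ) : Fin 4 → Plane :=
  ![!₂[a, b], !₂[b, a], !₂[-a, -b], !₂[-b, -a]]

theorem isSymmetricConfiguration (a b : ℝ) :
    IsSymmetricConfiguration (symmetricConfiguration a b) := by
  refine ⟨?_, ?_, ?_⟩ <;> ext i <;> fin_cases i <;> simp [symmetricConfiguration]

/-- Linearity in (a, b) reduces continuity and differentiation of symmetric motions to the two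
coordinates. -/
theorem symmetricConfiguration_eq_smul_add (a b : ℝ) (i : Fin 4) :
    symmetricConfiguration a b i =
      a • symmetricConfiguration 1 0 i + b • symmetricConfiguration 0 1 i := by
  fin_cases i <;> ext j <;> fin_cases j <;> simp [symmetricConfiguration]

theorem smul_symmetricConfiguration (c a b : ℝ) (i : Fin 4) :
    c • symmetricConfiguration a b i = symmetricConfiguration (c * a) (c * b) i := by
  fin_cases i <;> ext j <;> fin_cases j <;> simp [symmetricConfiguration]

theorem HasDerivAt.symmetricConfiguration {A B : ℝ → ℝ} {A' B' t : ℝ} (hA : HasDerivAt A A' t)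
    (hB : HasDerivAt B B' t) (i : Fin 4) :
    HasDerivAt (fun t => symmetricConfiguration (A t) (B t) i)
      (_root_.symmetricConfiguration A' B' i) t := by
  have := (hA.smul_const (_root_.symmetricConfiguration 1 0 i)).add
    (hB.smul_const (_root_.symmetricConfiguration 0 1 i))
  rw [symmetricConfiguration_eq_smul_add A' B' i]
  exact this.congr_of_eventuallyEq
    (Eventually.of_forall fun t => symmetricConfiguration_eq_smul_add (A t) (B t) i)

theorem symmetricConfiguration_zero_eq_one {a b : ℝ} :
    symmetricConfiguration a b 0 = symmetricConfiguration a b 1 ↔ a = b := by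
  refine ⟨fun h => congrArg (fun v : Plane => v 0) h, ?_⟩
  rintro rfl
  rfl

theorem symmetricConfiguration_zero_eq_three {a b : ℝ} :
    symmetricConfiguration a b 0 = symmetricConfiguration a b 3 ↔ a = -b := by
  refine ⟨fun h => congrArg (fun v : Plane => v 0) h, ?_⟩
  rintro rfl
  simp [symmetricConfiguration]

theorem collisionFree_symmetricConfiguration {a b : ℝ} :
    CollisionFree (symmetricConfiguration a b) ↔ a ≠ b ∧ a ≠ -b := by
  refine ⟨fun h => ⟨fun hab => ?_, fun hab => ?_⟩, fun ⟨h1, h2⟩ i j hij => ?_⟩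
  · exact absurd (h (symmetricConfiguration_zero_eq_one.2 hab)) (by decide)
  · exact absurd (h (symmetricConfiguration_zero_eq_three.2 hab)) (by decide)
  · have e0 := congrArg (fun v : Plane => v 0) hij
    have e1 := congrArg (fun v : Plane => v 1) hij
    fin_cases i <;> fin_cases j <;> simp [symmetricConfiguration] at e0 e1 ⊢ <;>
      first
        | exact h1 (by linarith)
        | exact h2 (by linarith)

theorem isSBC_symmetricConfiguration {a b : ℝ} (h0 : a ≠ 0 ∨ b ≠ 0)
    (h : ¬ CollisionFree (symmetricConfiguration a b)) : IsSBC (symmetricConfiguration a b) := by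
  rw [collisionFree_symmetricConfiguration, not_and_or, not_not, not_not] at h
  rcases h with rfl | rfl
  · refine Or.inl ⟨rfl, rfl, fun h => ?_⟩
    have : a = -a := congrArg (fun v : Plane => v 0) h
    have : a = 0 := by linarith
    simp [this] at h0
  · refine Or.inr ⟨by simp [symmetricConfiguration], by simp [symmetricConfiguration], fun h => ?_⟩
    have : -b = b := congrArg (fun v : Plane => v 0) h
    have : b = 0 := by linarith
    simp [this] at h0

theorem norm_plane (a b : ℝ) : ‖(!₂[a, b] : Plane)‖ = √(a ^ 2 + b ^ 2) := by
  simp [EuclideanSpace.norm_eq, Fin.sum_univ_two]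

theorem plane_sub (a b c d : ℝ) : (!₂[a, b] : Plane) - !₂[c, d] = !₂[a - c, b - d] := by
  ext i
  fin_cases i <;> simp

theorem norm_symmetricConfiguration_sub {u w : ℝ} (hu : 0 < u) (hw : 0 < w) :
    ‖symmetricConfiguration ((w + u) / 2) ((w - u) / 2) 0
      - symmetricConfiguration ((w + u) / 2) ((w - u) / 2) 1‖ = √2 * u ∧
    ‖symmetricConfiguration ((w + u) / 2) ((w - u) / 2) 0
      - symmetricConfiguration ((w + u) / 2) ((w - u) / 2) 2‖ = √2 * √(u ^ 2 + w ^ 2) ∧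
    ‖symmetricConfiguration ((w + u) / 2) ((w - u) / 2) 0
      - symmetricConfiguration ((w + u) / 2) ((w - u) / 2) 3‖ = √2 * w ∧
    ‖symmetricConfiguration ((w + u) / 2) ((w - u) / 2) 1
      - symmetricConfiguration ((w + u) / 2) ((w - u) / 2) 2‖ = √2 * w ∧
    ‖symmetricConfiguration ((w + u) / 2) ((w - u) / 2) 1
      - symmetricConfiguration ((w + u) / 2) ((w - u) / 2) 3‖ = √2 * √(u ^ 2 + w ^ 2) ∧
    ‖symmetricConfiguration ((w + u) / 2) ((w - u) / 2) 2
      - symmetricConfiguration ((w + u) / 2) ((w - u) / 2) 3‖ = √2 * u := by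
  have hs : ∀ c : ℝ, 0 < c → √2 * c = √(2 * c ^ 2) := fun c hc => by
    rw [Real.sqrt_mul (by norm_num), Real.sqrt_sq hc.le]
  rw [hs u hu, hs w hw, ← Real.sqrt_mul (by norm_num)]
  refine ⟨?_, ?_, ?_, ?_, ?_, ?_⟩
  all_goals
    refine (congrArg norm (plane_sub _ _ _ _)).trans ((norm_plane _ _).trans (congrArg _ ?_))
    ring

theorem potentialU_symmetricConfiguration (m : ℝ) {u w : ℝ} (hu : 0 < u) (hw : 0 < w) :
    potentialU (fun _ => m) (symmetricConfiguration ((w + u) / 2) ((w - u) / 2))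
      = √2 * m ^ 2 * (1 / u + 1 / w + 1 / √(u ^ 2 + w ^ 2)) := by
  obtain ⟨h01, h02, h03, h12, h13, h23⟩ := norm_symmetricConfiguration_sub hu hw
  have e0 : Finset.Ioi (0 : Fin 4) = {1, 2, 3} := by decide
  have e1 : Finset.Ioi (1 : Fin 4) = {2, 3} := by decide
  have e2 : Finset.Ioi (2 : Fin 4) = {3} := by decide
  have e3 : Finset.Ioi (3 : Fin 4) = ∅ := by decide
  have hR : 0 < √(u ^ 2 + w ^ 2) := Real.sqrt_pos.2 (by positivity)
  have h2 : √2 ^ 2 = 2 := Real.sq_sqrt (by norm_num)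
  have h20 : 0 < √2 := by positivity
  rw [potentialU, Fin.sum_univ_four, e0, e1, e2, e3]
  simp [h01, h02, h03, h12, h13, h23]
  generalize √(u ^ 2 + w ^ 2) = R at *
  generalize √2 = q at *
  field_simp
  rw [h2]
  ring

theorem kineticEnergy_symmetricConfiguration (m a b : ℝ) :
    kineticEnergy (fun _ => m) (symmetricConfiguration a b) = 2 * m * (a ^ 2 + b ^ 2) := by
  have h : ∀ a b : ℝ, ‖(!₂[a, b] : Plane)‖ ^ 2 = a ^ 2 + b ^ 2 := fun a b => by
    rw [norm_plane, Real.sq_sqrt (by positivity)]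
  rw [kineticEnergy, Fin.sum_univ_four]
  simp only [symmetricConfiguration, Matrix.cons_val, h]
  ring

theorem newtonForce_symmetricConfiguration (m : ℝ) {u w : ℝ} (hu : 0 < u) (hw : 0 < w)
    (i : Fin 4) :
    newtonForce (fun _ => m) (symmetricConfiguration ((w + u) / 2) ((w - u) / 2)) i
      = symmetricConfiguration
        (-(√2 * m ^ 2 / 4) * (1 / w ^ 2 + 1 / u ^ 2 + (w + u) / √(u ^ 2 + w ^ 2) ^ 3))
        (-(√2 * m ^ 2 / 4) * (1 / w ^ 2 - 1 / u ^ 2 + (w - u) / √(u ^ 2 + w ^ 2) ^ 3)) i := by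
  obtain ⟨h01, h02, h03, h12, h13, h23⟩ := norm_symmetricConfiguration_sub hu hw
  have hR : 0 < √(u ^ 2 + w ^ 2) := Real.sqrt_pos.2 (by positivity)
  have h2 : √2 ^ 2 = 2 := Real.sq_sqrt (by norm_num)
  have h20 : 0 < √2 := by positivity
  have h10 := (norm_sub_rev _ _).trans h01
  have h20' := (norm_sub_rev _ _).trans h02
  have h30 := (norm_sub_rev _ _).trans h03
  have h21 := (norm_sub_rev _ _).trans h12
  have h31 := (norm_sub_rev _ _).trans h13
  have h32 := (norm_sub_rev _ _).trans h23
  -- The omitted term j = i may be restored, being a multiple of ρᵢ - ρᵢ = 0.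
  rw [newtonForce, Finset.sum_erase _ (by simp), Fin.sum_univ_four]
  generalize √(u ^ 2 + w ^ 2) = R at *
  generalize √2 = q at *
  have h4 : q ^ 4 = 4 := by rw [show q ^ 4 = (q ^ 2) ^ 2 by ring, h2]; norm_num
  fin_cases i <;>
    simp only [Fin.zero_eta, Fin.mk_one, Fin.reduceFinMk, h01, h02, h03, h12, h13, h23, h10, h20',
      h30, h21, h31, h32, sub_self, smul_zero, add_zero, zero_add] <;>
    ext j <;> fin_cases j <;> simp [symmetricConfiguration] <;> field_simp <;> ring_nf <;>
    simp only [h4] <;> ring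

/-! ### Rescaling to arbitrary mass and energy -/

/-- A solution of the regularized equations which starts from the square of radius `r` with speed
`v`, and whose collisions and symmetries are those of the periodic orbit with the first collision
at the time `s₀`. -/
structure IsSymmetricRegularizedOrbit (m E r v s₀ : ℝ) (Q₁ Q₂ P₁ P₂ : ℝ → ℝ) : Prop where
  s₀_pos : 0 < s₀
  solves : SolvesRegularizedEquations m E Q₁ Q₂ P₁ P₂
  Q₁_zero : Q₁ 0 ^ 2 = r
  Q₂_zero : Q₂ 0 ^ 2 = r
  P₁_zero : P₁ 0 = -(4 * m * Q₁ 0 * v)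
  P₂_zero : P₂ 0 = 4 * m * Q₂ 0 * v
  shift₁ : ∀ s, Q₁ (s + 2 * s₀) ^ 2 = Q₂ s ^ 2
  shift₂ : ∀ s, Q₂ (s + 2 * s₀) ^ 2 = Q₁ s ^ 2
  reflect₁ : ∀ s, Q₁ (2 * s₀ - s) ^ 2 = Q₁ s ^ 2
  reflect₂ : ∀ s, Q₂ (2 * s₀ - s) ^ 2 = Q₂ s ^ 2
  zero₁ : ∀ s, Q₁ s = 0 ↔ ∃ k : ℤ, s = s₀ + 4 * s₀ * k
  zero₂ : ∀ s, Q₂ s = 0 ↔ ∃ k : ℤ, s = 3 * s₀ + 4 * s₀ * k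

/-- Rescaled normalized orbits solve the regularized equations. -/
theorem IsNormalizedOrbit.exists_rescaled {e p b : ℝ} {z : ℝ → Fin 4 → ℝ}
    (h : IsNormalizedOrbit e p b z) {m l : ℝ} (hm : 0 < m) (hl : 0 < l) :
    ∃ v, 0 < v ∧ ∃ s₀ Q₁ Q₂ P₁ P₂,
      IsSymmetricRegularizedOrbit m (√2 * m ^ 2 * e / l ^ 2) (l ^ 2) v s₀ Q₁ Q₂ P₁ P₂ := by
  -- This κ gives √2 m² = 4mκ². Scaling Q by l, P by 8mκ and time by lκ then multiplies every term
  -- of Γ by 4mκ²l².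
  set κ := √(√2 * m / 4) with hκ
  have hκ0 : 0 < κ := Real.sqrt_pos.2 (by positivity)
  have hκ2 : √2 * m = 4 * κ ^ 2 := by
    rw [hκ, Real.sq_sqrt (by positivity)]
    ring
  set c := l * κ with hc
  have hc0 : 0 < c := mul_pos hl hκ0
  have hd : ∀ i s, HasDerivAt (fun s => z (c * s) i) (normalizedField e (z (c * s)) i * c) s := by
    intro i s
    have h1 : HasDerivAt (fun s => c * s) c s := by simpa using (hasDerivAt_id s).const_mul c
    have h2 := hasDerivAt_pi.1 (h.deriv (c * s)) i
    exact h2.comp s h1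
  have hsq : ∀ x y : ℝ, √((l * x) ^ 4 + (l * y) ^ 4) = l ^ 2 * √(x ^ 4 + y ^ 4) := by
    intro x y
    rw [show (l * x) ^ 4 + (l * y) ^ 4 = (l ^ 2) ^ 2 * (x ^ 4 + y ^ 4) by ring,
      Real.sqrt_mul (by positivity), Real.sqrt_sq (by positivity)]
  have hR : ∀ s, 0 < √(z s 0 ^ 4 + z s 1 ^ 4) := by
    intro s
    apply Real.sqrt_pos.2
    by_cases h0 : z s 0 = 0
    · have h1 : z s 1 ≠ 0 := by
        intro h1
        obtain ⟨k, hk⟩ := (h.zero₁ s).1 h0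
        obtain ⟨j, hj⟩ := (h.zero₂ s).1 h1
        have hb := h.b_pos
        have : (2 * k : ℝ) = 1 + 2 * j := by
          have : b * (2 * k) = b * (1 + 2 * j) := by linarith
          exact mul_left_cancel₀ hb.ne' this
        have : 2 * k = 1 + 2 * j := by exact_mod_cast this
        omega
      positivity
    · positivity
  have hE : √2 * m ^ 2 * e / l ^ 2 * l ^ 2 = √2 * m ^ 2 * e := by field_simp
  have hm2 : √2 * m ^ 2 = 4 * m * κ ^ 2 := by linear_combination m * hκ2
  have hb := h.b_pos
  have hcb : c * (b / c) = b := by field_simp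
  have hp := h.p_pos
  -- The speed is determined by 8mκp = 4mlv.
  refine ⟨2 * κ * p / l, by positivity, b / c, fun s => l * z (c * s) 0, fun s => l * z (c * s) 1,
    fun s => 8 * m * κ * z (c * s) 2, fun s => 8 * m * κ * z (c * s) 3, ?_⟩
  refine ⟨by positivity, ⟨fun s => ?_, fun s => ?_, fun s => ?_, fun s => ?_, fun s => ?_⟩, ?_, ?_,
    ?_, ?_, fun s => ?_, fun s => ?_, fun s => ?_, fun s => ?_, fun s => ?_, fun s => ?_⟩
  · refine ((hd 0 s).const_mul l).congr_deriv ?_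
    simp [normalizedField, hc]
    field_simp
  · refine ((hd 1 s).const_mul l).congr_deriv ?_
    simp [normalizedField, hc]
    field_simp
  · refine ((hd 2 s).const_mul (8 * m * κ)).congr_deriv ?_
    have := hR (c * s)
    simp only [normalizedField, regularizedForce, hsq, mul_assoc 2 (√2) (m ^ 2)]
    simp
    rw [hm2, hc]
    field_simp
    ring
  · refine ((hd 3 s).const_mul (8 * m * κ)).congr_deriv ?_
    have := hR (c * s)
    rw [add_comm] at this
    simp only [normalizedField, regularizedForce, hsq, mul_assoc 2 (√2) (m ^ 2)]
    simp
    rw [hm2, hc]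
    field_simp
    ring
  · have h1 := h.level (c * s)
    have := hR (c * s)
    rw [normalizedHamiltonian] at h1
    rw [regularizedHamiltonian, hsq, hm2]
    have : 4 * m * κ ^ 2 * l ^ 2 * (z (c * s) 2 ^ 2 * z (c * s) 1 ^ 2
        + z (c * s) 3 ^ 2 * z (c * s) 0 ^ 2 - z (c * s) 0 ^ 2 - z (c * s) 1 ^ 2
        - z (c * s) 0 ^ 2 * z (c * s) 1 ^ 2 / √(z (c * s) 0 ^ 4 + z (c * s) 1 ^ 4)
        - e * z (c * s) 0 ^ 2 * z (c * s) 1 ^ 2) = 0 := by rw [h1, mul_zero]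
    rw [← this]
    field_simp
    ring
  · simp [h.start]
  · simp [h.start]
  · simp [h.start]
    field_simp
    ring
  · simp [h.start]
    field_simp
    ring
  -- The rotation introduces signs, and its square is -1, so only the squares of the Q's have period
  -- 4s₀.
  · rw [show c * (s + 2 * (b / c)) = c * s + 2 * b by linear_combination 2 * hcb, h.rotate,
      phaseRotation_apply]
    simp [mul_pow]
  · rw [show c * (s + 2 * (b / c)) = c * s + 2 * b by linear_combination 2 * hcb, h.rotate,
      phaseRotation_apply]
    simp
  · rw [show c * (2 * (b / c) - s) = 2 * b - c * s by linear_combination 2 * hcb, h.reflect]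
    simp [phaseReflection]
  · rw [show c * (2 * (b / c) - s) = 2 * b - c * s by linear_combination 2 * hcb, h.reflect]
    simp [phaseReflection]
  · rw [mul_eq_zero, or_iff_right hl.ne', h.zero₁]
    refine exists_congr fun k => ?_
    rw [← mul_right_inj' hc0.ne' (b := s), show c * (b / c + 4 * (b / c) * k) = b + 4 * b * k by
      linear_combination (1 + 4 * (k : ℝ)) * hcb]
  · rw [mul_eq_zero, or_iff_right hl.ne', h.zero₂]
    refine exists_congr fun k => ?_
    rw [← mul_right_inj' hc0.ne' (b := s), show c * (3 * (b / c) + 4 * (b / c) * k) =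
      3 * b + 4 * b * k by linear_combination (3 + 4 * (k : ℝ)) * hcb]

/-! ### The clock and the physical motion -/

namespace IsSymmetricRegularizedOrbit

variable {m E r v s₀ : ℝ} {Q₁ Q₂ P₁ P₂ : ℝ → ℝ}

/-- A common zero would give 1 + 4k = 3 + 4j, which is impossible by parity. -/
theorem ne_zero_or (h : IsSymmetricRegularizedOrbit m E r v s₀ Q₁ Q₂ P₁ P₂) (s : ℝ) :
    Q₁ s ≠ 0 ∨ Q₂ s ≠ 0 := by
  by_contra! hcon
  obtain ⟨k, hk⟩ := (h.zero₁ s).1 hcon.1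
  obtain ⟨j, hj⟩ := (h.zero₂ s).1 hcon.2
  have : (2 * k : ℝ) = 1 + 2 * j := by
    have : s₀ * (2 * k) = s₀ * (1 + 2 * j) := by linarith
    exact mul_left_cancel₀ h.s₀_pos.ne' this
  have : 2 * k = 1 + 2 * j := by exact_mod_cast this
  omega

/-- The clock is the integral of Q₁²Q₂². It increases strictly because the integrand has only
countably many zeros, and is onto because each period adds the same positive amount. -/
theorem exists_clock (h : IsSymmetricRegularizedOrbit m E r v s₀ Q₁ Q₂ P₁ P₂) :
    ∃ τ : ℝ → ℝ, τ 0 = 0 ∧ (∀ s, HasDerivAt τ (Q₁ s ^ 2 * Q₂ s ^ 2) s) ∧ StrictMono τ ∧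
      Function.Surjective τ ∧ ∀ s, τ (s + 4 * s₀) = τ s + τ (4 * s₀) := by
  have hc : Continuous fun s => Q₁ s ^ 2 * Q₂ s ^ 2 := by
    have h1 : Continuous Q₁ :=
      continuous_iff_continuousAt.2 fun s => (h.solves.hQ₁ s).continuousAt
    have h2 : Continuous Q₂ :=
      continuous_iff_continuousAt.2 fun s => (h.solves.hQ₂ s).continuousAt
    fun_prop
  set τ : ℝ → ℝ := fun s => ∫ x in (0)..s, Q₁ x ^ 2 * Q₂ x ^ 2 with hτ
  have h0 : τ 0 = 0 := by simp [hτ]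
  have hd : ∀ s, HasDerivAt τ (Q₁ s ^ 2 * Q₂ s ^ 2) s := fun s =>
    (hc.integral_hasStrictDerivAt 0 s).hasDerivAt
  have hcont : Continuous τ := continuous_iff_continuousAt.2 fun s => (hd s).continuousAt
  have hmono : Monotone τ :=
    monotone_of_hasDerivAt_nonneg hd fun s => by positivity
  have hcount : {s | Q₁ s = 0 ∨ Q₂ s = 0}.Countable := by
    have e1 : {s | Q₁ s = 0 ∨ Q₂ s = 0} ⊆ range (fun k : ℤ => s₀ + 4 * s₀ * k) ∪
        range (fun k : ℤ => 3 * s₀ + 4 * s₀ * k) := by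
      rintro s (hs | hs)
      · obtain ⟨k, hk⟩ := (h.zero₁ s).1 hs
        exact Or.inl ⟨k, hk.symm⟩
      · obtain ⟨k, hk⟩ := (h.zero₂ s).1 hs
        exact Or.inr ⟨k, hk.symm⟩
    exact ((countable_range _).union (countable_range _)).mono e1
  have hstrict : StrictMono τ := by
    refine fun a b hab => lt_of_le_of_ne (hmono hab.le) fun heq => ?_
    -- If τ took equal values at a < b, it would be constant between them, with zero derivative at
    -- some point where the integrand is positive.
    obtain ⟨s, hs, hsab⟩ := (hcount.dense_compl ℝ).exists_between hab
    have hloc : τ =ᶠ[𝓝 s] fun _ => τ a := by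
      filter_upwards [Ioo_mem_nhds hsab.1 hsab.2] with t ht
      exact le_antisymm ((hmono ht.2.le).trans heq.ge) (hmono ht.1.le)
    have := (hd s).unique ((hasDerivAt_const s (τ a)).congr_of_eventuallyEq hloc)
    rcases mul_eq_zero.1 this with h1 | h1
    · exact hs (Or.inl (pow_eq_zero_iff two_ne_zero |>.1 h1))
    · exact hs (Or.inr (pow_eq_zero_iff two_ne_zero |>.1 h1))
  have hadd : ∀ s, τ (s + 4 * s₀) = τ s + τ (4 * s₀) := by
    have hd' : ∀ s, HasDerivAt (fun s => τ (s + 4 * s₀) - τ s) 0 s := fun s => by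
      refine (((hd (s + 4 * s₀)).comp_add_const s (4 * s₀)).sub (hd s)).congr_deriv ?_
      rw [show s + 4 * s₀ = s + 2 * s₀ + 2 * s₀ by ring, h.shift₁, h.shift₂, h.shift₂, h.shift₁]
      ring
    intro s
    have := is_const_of_deriv_eq_zero (fun s => (hd' s).differentiableAt)
      (fun s => (hd' s).deriv) s 0
    simp only [zero_add, h0, sub_zero] at this
    linarith
  have hT : 0 < τ (4 * s₀) := h0 ▸ hstrict (by linarith [h.s₀_pos] : (0 : ℝ) < 4 * s₀)
  have hadd_nat : ∀ (n : ℕ) s, τ (s + n * (4 * s₀)) = τ s + n * τ (4 * s₀) := by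
    intro n
    induction n with
    | zero => simp
    | succ n ih =>
      intro s
      push_cast
      rw [show s + (n + 1) * (4 * s₀) = s + n * (4 * s₀) + 4 * s₀ by ring, hadd, ih]
      ring
  refine ⟨τ, h0, hd, hstrict, fun t => ?_, hadd⟩
  obtain ⟨n, hn⟩ := exists_nat_ge (|t| / τ (4 * s₀))
  rw [div_le_iff₀ hT] at hn
  have h1 := hadd_nat n 0
  have h2 := hadd_nat n (-(n * (4 * s₀)))
  rw [neg_add_cancel, h0] at h2
  rw [h0] at h1
  exact mem_range_of_exists_le_of_exists_ge hcont
    ⟨-(n * (4 * s₀)), by linarith [neg_abs_le t]⟩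
    ⟨0 + n * (4 * s₀), by rw [h1]; linarith [le_abs_self t]⟩

/-- The accelerations of `x₁ - x₂` and `x₁ + x₂`. -/
theorem hasDerivAt_velocity {m E : ℝ} (hm : 0 < m) {Q₁ Q₂ P₁ P₂ : ℝ → ℝ}
    (h : SolvesRegularizedEquations m E Q₁ Q₂ P₁ P₂) {s : ℝ} (h1 : Q₁ s ≠ 0) (h2 : Q₂ s ≠ 0) :
    HasDerivAt (fun s => P₁ s / (4 * m * Q₁ s))
      (-(√2 * m / 2) * (1 / (Q₁ s ^ 2) ^ 2
        + Q₁ s ^ 2 / √((Q₁ s ^ 2) ^ 2 + (Q₂ s ^ 2) ^ 2) ^ 3) * (Q₁ s ^ 2 * Q₂ s ^ 2)) s ∧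
    HasDerivAt (fun s => P₂ s / (4 * m * Q₂ s))
      (-(√2 * m / 2) * (1 / (Q₂ s ^ 2) ^ 2
        + Q₂ s ^ 2 / √((Q₁ s ^ 2) ^ 2 + (Q₂ s ^ 2) ^ 2) ^ 3) * (Q₁ s ^ 2 * Q₂ s ^ 2)) s := by
  have hlev := h.level s
  have hR : 0 < √(Q₁ s ^ 4 + Q₂ s ^ 4) := Real.sqrt_pos.2 (by positivity)
  have e1 : (Q₁ s ^ 2) ^ 2 + (Q₂ s ^ 2) ^ 2 = Q₁ s ^ 4 + Q₂ s ^ 4 := by ring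
  have hR2 : √(Q₁ s ^ 4 + Q₂ s ^ 4) ^ 2 = Q₁ s ^ 4 + Q₂ s ^ 4 := Real.sq_sqrt (by positivity)
  have d1 := (h.hP₁ s).div ((h.hQ₁ s).const_mul (4 * m)) (by positivity)
  have d2 := (h.hP₂ s).div ((h.hQ₂ s).const_mul (4 * m)) (by positivity)
  rw [e1]
  rw [regularizedHamiltonian] at hlev
  rw [regularizedForce] at d1
  rw [regularizedForce, add_comm (Q₂ s ^ 4)] at d2
  generalize √(Q₁ s ^ 4 + Q₂ s ^ 4) = R at *
  generalize √2 = q at *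
  -- Differentiating the quotients leaves squares of both momenta; a multiple of Γ = 0 removes them.
  -- The remaining factor Q₁²Q₂² is dt/ds.
  constructor
  · refine d1.congr_deriv ?_
    linear_combination (norm := (field_simp; ring)) (-1 / (2 * m * Q₁ s ^ 2)) * hlev
  · refine d2.congr_deriv ?_
    linear_combination (norm := (field_simp; ring)) (-1 / (2 * m * Q₂ s ^ 2)) * hlev

/-- The motion described by a solution of the regularized equations is a regularized solution of
the four-body problem, and has the symmetries of the orbit. -/
theorem hasSymmetricPeriodicSBCOrbit (hm : 0 < m) (hr : 0 < r)
    (h : IsSymmetricRegularizedOrbit m E r v s₀ Q₁ Q₂ P₁ P₂) :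
    HasSymmetricPeriodicSBCOrbit m E r v := by
  obtain ⟨τ, hτ0, hτd, hτm, hτs, hτadd⟩ := h.exists_clock
  have hs₀ := h.s₀_pos
  let σ : ℝ → ℝ := fun t => (hτm.orderIsoOfSurjective τ hτs).symm t
  have hτσ : ∀ t, τ (σ t) = t := (hτm.orderIsoOfSurjective τ hτs).apply_symm_apply
  have hστ : ∀ s, σ (τ s) = s := (hτm.orderIsoOfSurjective τ hτs).symm_apply_apply
  have hσc : Continuous σ := (hτm.orderIsoOfSurjective τ hτs).symm.continuous
  -- The inverse clock is differentiated only off collisions, where dt/ds ≠ 0; at collisions its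
  -- continuity suffices.
  have hσd : ∀ t, Q₁ (σ t) ≠ 0 → Q₂ (σ t) ≠ 0 →
      HasDerivAt σ (Q₁ (σ t) ^ 2 * Q₂ (σ t) ^ 2)⁻¹ t := fun t h1 h2 =>
    HasDerivAt.of_local_left_inverse hσc.continuousAt (hτd (σ t)) (by positivity)
      (Eventually.of_forall hτσ)
  have hc₁ : Continuous Q₁ :=
    continuous_iff_continuousAt.2 fun s => (h.solves.hQ₁ s).continuousAt
  have hc₂ : Continuous Q₂ :=
    continuous_iff_continuousAt.2 fun s => (h.solves.hQ₂ s).continuousAt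
  -- the motion and its velocities
  let C : ℝ → Fin 4 → Plane := fun s =>
    symmetricConfiguration ((Q₂ s ^ 2 + Q₁ s ^ 2) / 2) ((Q₂ s ^ 2 - Q₁ s ^ 2) / 2)
  let D : ℝ → Fin 4 → Plane := fun s =>
    symmetricConfiguration ((P₂ s / (4 * m * Q₂ s) + P₁ s / (4 * m * Q₁ s)) / 2)
      ((P₂ s / (4 * m * Q₂ s) - P₁ s / (4 * m * Q₁ s)) / 2)
  let x : Fin 4 → ℝ → Plane := fun i t => C (σ t) i
  have hx : ∀ i s, x i (τ s) = C s i := fun i s => by simp only [x, hστ]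
  have hfree : ∀ s, CollisionFree (C s) ↔ Q₁ s ≠ 0 ∧ Q₂ s ≠ 0 := fun s => by
    rw [collisionFree_symmetricConfiguration]
    refine and_congr (not_congr ⟨fun h' => ?_, fun h' => ?_⟩) (not_congr ⟨fun h' => ?_, fun h' => ?_⟩)
    · exact pow_eq_zero_iff two_ne_zero |>.1 (by linarith)
    · rw [h']; ring
    · exact pow_eq_zero_iff two_ne_zero |>.1 (by linarith)
    · rw [h']; ring
  have hxd : ∀ t, Q₁ (σ t) ≠ 0 → Q₂ (σ t) ≠ 0 → ∀ i, HasDerivAt (x i) (D (σ t) i) t := by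
    intro t h1 h2 i
    have d1 := (((h.solves.hQ₁ (σ t)).comp t (hσd t h1 h2)).pow 2)
    have d2 := (((h.solves.hQ₂ (σ t)).comp t (hσd t h1 h2)).pow 2)
    refine ((d2.add d1).div_const 2).symmetricConfiguration ((d2.sub d1).div_const 2) i
      |>.congr_deriv ?_
    refine congrArg₂ (symmetricConfiguration · · i) ?_ ?_ <;> simp only [Function.comp] <;>
      field_simp <;> ring
  -- Newton's equations differentiate `deriv (x i)`, so the velocity formula is needed on a
  -- neighbourhood; being collision-free is an open condition.
  have hev : ∀ t, Q₁ (σ t) ≠ 0 → Q₂ (σ t) ≠ 0 → ∀ i, deriv (x i) =ᶠ[𝓝 t] fun t => D (σ t) i := by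
    intro t h1 h2 i
    filter_upwards [(hc₁.comp hσc).continuousAt.eventually_ne h1,
      (hc₂.comp hσc).continuousAt.eventually_ne h2] with t' h1' h2'
    exact (hxd t' h1' h2' i).deriv
  have hsolution : IsRegularizedSolution m E x τ Q₁ Q₂ P₁ P₂ := by
    refine ⟨fun i => ?_, ?_, ?_, fun t => isSymmetricConfiguration _ _, fun t ht => ?_, h.solves, hτ0,
      hτd, hτm, hτs, fun s => ?_, fun s => ?_, fun s hs => ?_, fun s hs => ?_⟩
    · have : x i = fun t => ((Q₂ (σ t) ^ 2 + Q₁ (σ t) ^ 2) / 2) • symmetricConfiguration 1 0 i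
          + ((Q₂ (σ t) ^ 2 - Q₁ (σ t) ^ 2) / 2) • symmetricConfiguration 0 1 i :=
        funext fun t => symmetricConfiguration_eq_smul_add _ _ _
      rw [this]
      fun_prop
    · intro t ht i
      obtain ⟨h1, h2⟩ := (hfree (σ t)).1 ht
      refine ⟨(hxd t h1 h2 i).differentiableAt, ?_⟩
      obtain ⟨a1, a2⟩ := hasDerivAt_velocity hm h.solves h1 h2
      have b1 := a1.comp t (hσd t h1 h2)
      have b2 := a2.comp t (hσd t h1 h2)
      have key := (((b2.add b1).div_const 2).symmetricConfiguration ((b2.sub b1).div_const 2) i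
        ).const_smul m
      refine HasDerivAt.congr_deriv (key.congr_of_eventuallyEq ((hev t h1 h2 i).fun_comp (m • ·))) ?_
      have hforce := newtonForce_symmetricConfiguration m (u := Q₁ (σ t) ^ 2) (w := Q₂ (σ t) ^ 2)
        (by positivity) (by positivity) i
      refine Eq.trans ?_ hforce.symm
      rw [smul_symmetricConfiguration]
      have hR : 0 < √((Q₁ (σ t) ^ 2) ^ 2 + (Q₂ (σ t) ^ 2) ^ 2) := Real.sqrt_pos.2 (by positivity)
      refine congrArg₂ (symmetricConfiguration · · i) ?_ ?_ <;> field_simp <;> ring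
    · intro t ht
      obtain ⟨h1, h2⟩ := (hfree (σ t)).1 ht
      have e1 : (fun i => deriv (x i) t) = D (σ t) := funext fun i => (hxd t h1 h2 i).deriv
      rw [e1, kineticEnergy_symmetricConfiguration]
      have hpot := potentialU_symmetricConfiguration m (u := Q₁ (σ t) ^ 2) (w := Q₂ (σ t) ^ 2)
        (by positivity) (by positivity)
      have hlev := h.solves.level (σ t)
      have hR : 0 < √(Q₁ (σ t) ^ 4 + Q₂ (σ t) ^ 4) := Real.sqrt_pos.2 (by positivity)
      rw [regularizedHamiltonian] at hlev
      have hpot' : potentialU (fun _ => m) (fun i => x i t) = _ := hpot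
      rw [hpot', show (Q₁ (σ t) ^ 2) ^ 2 + (Q₂ (σ t) ^ 2) ^ 2 = Q₁ (σ t) ^ 4 + Q₂ (σ t) ^ 4 by ring]
      generalize √(Q₁ (σ t) ^ 4 + Q₂ (σ t) ^ 4) = R at *
      -- Off collisions, Γ/(Q₁²Q₂²) is the energy minus E.
      linear_combination (norm := (field_simp; ring)) (1 / (Q₁ (σ t) ^ 2 * Q₂ (σ t) ^ 2)) * hlev
    · refine isSBC_symmetricConfiguration ?_ ht
      by_contra! hcon
      rcases h.ne_zero_or (σ t) with h' | h'
      · exact h' (pow_eq_zero_iff two_ne_zero |>.1 (by linarith))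
      · exact h' (pow_eq_zero_iff two_ne_zero |>.1 (by linarith))
    · rw [hx]
      simp [C, symmetricConfiguration]
      ring
    · rw [hx]
      simp [C, symmetricConfiguration]
      ring
    · simp only [hx] at hs
      obtain ⟨h1, h2⟩ := (hfree s).1 hs
      rw [(hxd (τ s) (by rwa [hστ]) (by rwa [hστ]) 0).deriv, hστ]
      simp [D, symmetricConfiguration]
      field_simp
      ring
    · simp only [hx] at hs
      obtain ⟨h1, h2⟩ := (hfree s).1 hs
      rw [(hxd (τ s) (by rwa [hστ]) (by rwa [hστ]) 0).deriv, hστ]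
      simp [D, symmetricConfiguration]
      field_simp
      ring
  have h01 : ∀ s, x 0 (τ s) = x 1 (τ s) ↔ Q₁ s = 0 := fun s => by
    rw [hx, hx, symmetricConfiguration_zero_eq_one]
    refine ⟨fun h' => pow_eq_zero_iff two_ne_zero |>.1 (by linarith), fun h' => by rw [h']; ring⟩
  have h03 : ∀ s, x 0 (τ s) = x 3 (τ s) ↔ Q₂ s = 0 := fun s => by
    rw [hx, hx, symmetricConfiguration_zero_eq_three]
    refine ⟨fun h' => pow_eq_zero_iff two_ne_zero |>.1 (by linarith), fun h' => by rw [h']; ring⟩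
  have hC : ∀ s, C (s + 4 * s₀) = C s := fun s => by
    simp only [C]
    rw [show s + 4 * s₀ = s + 2 * s₀ + 2 * s₀ by ring, h.shift₁, h.shift₂, h.shift₂, h.shift₁]
  have hper : ∀ i, Function.Periodic (x i) (τ (4 * s₀)) := fun i t => by
    have := hx i (σ t + 4 * s₀)
    rw [hτadd, hτσ, hC] at this
    exact this
  refine ⟨x, τ, Q₁, Q₂, P₁, P₂, s₀, hsolution, ⟨?_, ?_⟩, hs₀, ⟨⟨hs₀.le, ?_⟩, ?_⟩,
    fun s => (h01 s).trans (h.zero₁ s), fun s => (h03 s).trans (h.zero₂ s), fun i s => ?_,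
    fun s => ?_, fun i s => ?_, fun i s => ?_, hper⟩
  · have : (fun i => x i 0) = C 0 := by
      funext i
      rw [← hx, hτ0]
    rw [this]
    simp [C, symmetricConfiguration, h.Q₁_zero, h.Q₂_zero]
  · have hq1 : Q₁ 0 ≠ 0 := fun h' => by
      have := h.Q₁_zero
      simp [h'] at this
      exact hr.ne this
    have hq2 : Q₂ 0 ≠ 0 := fun h' => by
      have := h.Q₂_zero
      simp [h'] at this
      exact hr.ne this
    have hσ0 : σ 0 = 0 := by rw [← hτ0, hστ, hτ0]
    have : (fun i => deriv (x i) 0) = D 0 := by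
      funext i
      rw [(hxd 0 (by rwa [hσ0]) (by rwa [hσ0]) i).deriv, hσ0]
    have e1 : P₁ 0 / (4 * m * Q₁ 0) = -v := by
      rw [h.P₁_zero]
      field_simp
    have e2 : P₂ 0 / (4 * m * Q₂ 0) = v := by
      rw [h.P₂_zero]
      field_simp
    rw [this]
    simp [D, symmetricConfiguration, e1, e2]
  · simp only [hx]
    rw [hfree]
    exact fun h' => h'.1 ((h.zero₁ s₀).2 ⟨0, by simp⟩)
  · rintro s ⟨hs, hcoll⟩
    simp only [hx] at hcoll
    rw [hfree, not_and_or, not_not, not_not, h.zero₁, h.zero₂] at hcoll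
    -- Nonnegative times exclude k ≤ -1, so the earliest collisions of the two kinds are at s₀ and
    -- 3s₀.
    have hk : ∀ (j : ℝ) (k : ℤ), j < 4 → s = j * s₀ + 4 * s₀ * k → (0 : ℝ) ≤ k := by
      intro j k hj hk
      have : (-1 : ℝ) < k := by
        by_contra! hcon
        nlinarith
      have : -1 < k := by exact_mod_cast this
      exact_mod_cast (by omega : 0 ≤ k)
    rcases hcoll with ⟨k, hk'⟩ | ⟨k, hk'⟩
    · have := hk 1 k (by norm_num) (by linarith)
      nlinarith
    · have := hk 3 k (by norm_num) hk'
      nlinarith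
  · rw [hx, hx]
    simp only [C, h.reflect₁, h.reflect₂]
  · rw [hx, hx]
    simp only [C, h.shift₁, h.shift₂]
    ext i
    fin_cases i <;> simp [symmetricConfiguration] <;> ring
  · simp only [hx, hC]
  · simp only [hτadd]
    have : (fun t => x i (t + τ (4 * s₀))) = x i := funext (hper i)
    -- Periodicity of x passes to `deriv` without any differentiability, hence also at collisions.
    rw [← deriv_comp_add_const, this]

end IsSymmetricRegularizedOrbit

theorem mainTheorem1 (m : ℝ) (hm : 0 < m) :
    (∀ E : ℝ, E < 0 → ∃ r : ℝ, 0 < r ∧ ∃ v : ℝ, 0 < v ∧ HasSymmetricPeriodicSBCOrbit m E r v) ∧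
    (∃ E : ℝ, E < 0 ∧ ∃ v : ℝ, 0 < v ∧ HasSymmetricPeriodicSBCOrbit m E 1 v) := by
  obtain ⟨e, p, b, z, h⟩ := exists_normalizedOrbit
  have he := h.e_neg
  have hneg : √2 * m ^ 2 * e < 0 := mul_neg_of_pos_of_neg (by positivity) he
  refine ⟨fun E hE => ?_, ?_⟩
  · have hq : 0 < √2 * m ^ 2 * e / E := div_pos_of_neg_of_neg hneg hE
    -- The choice l² = √2 m² e/E makes the rescaled energy equal to E; it is positive because e and
    -- E are both negative.
    obtain ⟨v, hv, s₀, Q₁, Q₂, P₁, P₂, horbit⟩ := h.exists_rescaled hm (Real.sqrt_pos.2 hq)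
    rw [Real.sq_sqrt hq.le, div_div_cancel₀ hneg.ne] at horbit
    exact ⟨_, hq, v, hv, horbit.hasSymmetricPeriodicSBCOrbit hm hq⟩
  · obtain ⟨v, hv, s₀, Q₁, Q₂, P₁, P₂, horbit⟩ := h.exists_rescaled hm one_pos
    rw [one_pow, div_one] at horbit
    exact ⟨_, hneg, v, hv, horbit.hasSymmetricPeriodicSBCOrbit hm one_pos⟩
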